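/- Let $P$ be a polynomial endofunctor represented by an arbitrary diagram of groupoids $I \xleftarrow{s} E \xrightarrow{p} B \xrightarrow{t} I$. Conventions. All fibres and pullbacks are homotopy fibres and homotopy pullbacks: for a functor of groupoids $q\colon X\to Y$ and $y\in Y$, the fibre over $y$ has as objects the pairs $(x,\ \phi\colon qx\to y)$. For a functor $G$ from a groupoid $Y$ to groupoids, the homotopy sum $\int^{y\in Y} G(y)$ is its Grothendieck construction. For a groupoid $X$, $\mathbf{fam}\,X$ is the groupoid of finite families of objects of $X$ (finite sets $Z$ with a map $Z\to X$; arrows are bijections over $X$ up to a specified isomorphism). Trees. A tree is a diagram of finite sets $A\xleftarrow{s} M\xrightarrow{p} N\xrightarrow{t} A$ (edges, nodes with a marked input edge, nodes) such that $t$ is injective, $s$ is injective with complement a single edge (the root), and from every edge one reaches the root by finitely many steps $s(m)\mapsto t(p(m))$. The leaves are the edges not in the image of $t$. A tree embedding is a morphism of such diagrams whose middle square is cartesian. A $P$-tree is a tree together with a map of diagrams to $P$, with squares commuting up to specified isomorphisms and with middle square a homotopy pullback; embeddings of $P$-trees are arrows in the weak slice over $P$, that is, tree embeddings together with compatible 2-cells.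 Let $\mathbf T$ be the groupoid of $P$-trees and their isomorphisms, and $\mathbf F=\mathbf{fam}\,\mathbf T$ the groupoid of $P$-forests. Let $L\colon\mathbf T\to\mathbf{fam}\,I$ be the functor sending a tree to its $I$-coloured set of leaves, and $R\colon\mathbf F\to\mathbf{fam}\,I$ the functor sending a forest to its $I$-coloured set of roots. For $N\in\mathbf{fam}\,I$ write $\mathbf F_N$ for the fibre of $R$ over $N$ and ${}_N\mathbf T$ for the fibre of $L$ over $N$. Cuts. Let $\mathbf C$ be the groupoid of root-preserving embeddings $c\colon S\rightarrowtail T$ of $P$-trees (arrows: isomorphisms of such embeddings), and let $m\colon\mathbf C\to\mathbf T$ send $c$ to $T$. The fibres of $m$ are discrete, and $\mathrm{cut}(T)$ denotes the set of components of the fibre of $m$ over $T$, regarded as a discrete groupoid. For a cut $c\colon S\rightarrowtail T$ put $S_c=S$ and let $P_c$ be the forest, indexed by the leaves of $S$, of the ideal subtrees of $T$ generated by the images of these leaves (the edge itself and everything above it). Theorem. There are equivalences of groupoids over $\mathbf F\times\mathbf T$ $$\int^{T\in\mathbf T}\mathrm{cut}(T)\;\simeq\;\int^{S\in\mathbf T}\mathbf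 F_{L(S)}\;\simeq\;\int^{N\in\mathbf{fam}\,I}\mathbf F_N\times{}_N\mathbf T .$$ Here the maps to $\mathbf F\times\mathbf T$ are, respectively: the one sending a cut $c$ to $(P_c,S_c)$; the one sending $(S,Q)$ with $Q\in\mathbf F_{L(S)}$ to $(Q,S)$; and the one sending $(N,Q,S)$ with $Q\in\mathbf F_N$ and $S\in{}_N\mathbf T$ to $(Q,S)$. An equivalence over $\mathbf F\times\mathbf T$ is an equivalence that commutes with these maps up to natural isomorphism. -/

import Mathlib

open CategoryTheory

namespace FaaDiBruno

universe v v₁ v₂ v₃ u u₁ u₂ u₃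

/-! ### Groupoids: homotopy pullback, homotopy fibres, homotopy sums, families -/

section Groupoids

/-- The homotopy pullback of `f : X ⥤ S` and `g : Y ⥤ S`: objects are triples `(x, y, φ : f x ⟶ g y)`,
arrows are pairs of arrows making the evident square commute.  For groupoids this is the comma
category. -/
abbrev HPullback {X : Type u₁} {Y : Type u₂} {S : Type u₃} [Groupoid.{v₁} X] [Groupoid.{v₂} Y]
    [Groupoid.{v₃} S] (f : X ⥤ S) (g : Y ⥤ S) :=
  Comma f g

/-- The homotopy fibre of `p : E ⥤ B` over `b`: objects are pairs `(e, φ : p e ⟶ b)`, arrows are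
arrows of `E` compatible with the maps to `b`. -/
abbrev HFibre {E : Type u₁} {B : Type u₂} [Groupoid.{v₁} E] [Groupoid.{v₂} B]
    (p : E ⥤ B) (b : B) :=
  CostructuredArrow p b

/-- The homotopy fibres of `p : E ⥤ B`, as a strict functor on `B`. -/
abbrev fibreFunctor {E : Type u₁} {B : Type u₂} [Groupoid.{v₁} E] [Groupoid.{v₂} B]
    (p : E ⥤ B) : B ⥤ Cat.{v₁, max u₁ v₂} :=
  CostructuredArrow.functor p

/-- The homotopy sum of a family `F` indexed by a groupoid `B`: objects are pairs
`(b, x)` with `x` in `F b`, arrows `(b, x) ⟶ (b', x')` are pairs `(σ : b ⟶ b', φ : (F σ) x ⟶ x')`. -/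
abbrev HoSum {B : Type u} [Groupoid.{v} B] (F : B ⥤ Cat.{v₁, u₁}) :=
  Grothendieck F

/-- The pointwise product of two families of categories. -/
@[simps]
def prodFamily {B : Type u} [Groupoid.{v} B] (F : B ⥤ Cat.{v₁, u₁}) (G : B ⥤ Cat.{v₂, u₂}) :
    B ⥤ Cat.{max v₁ v₂, max u₁ u₂} where
  obj b := Cat.of (F.obj b × G.obj b)
  map f := ((F.map f).toFunctor.prod (G.map f).toFunctor).toCatHom
  map_id b := by
    ext
    simp only [F.map_id, G.map_id]
    rfl
  map_comp f g := by
    ext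
    simp only [F.map_comp, G.map_comp]
    rfl

theorem prodFibre_eqToHom {C : Type u₁} {D : Type u₂} {B : Type u₃} [Groupoid.{v₁} C]
    [Groupoid.{v₂} D] [Groupoid.{v₃} B] {p : C ⥤ B} {q : D ⥤ B} {b : B}
    {X Y : HFibre p b × HFibre q b} (h : X = Y) :
    (eqToHom h).1.left = eqToHom (congrArg (fun Z => Z.1.left) h) ∧
      (eqToHom h).2.left = eqToHom (congrArg (fun Z => Z.2.left) h) := by
  subst h
  exact ⟨rfl, rfl⟩

/-- The functor from the homotopy sum of the products `C_b × D_b` of homotopy fibres to `C × D`,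
sending `(b, ((x, φ), (y, ψ)))` to `(x, y)`. -/
def prodFibreMap {C : Type u₁} {D : Type u₂} {B : Type u₃} [Groupoid.{v₁} C]
    [Groupoid.{v₂} D] [Groupoid.{v₃} B] (p : C ⥤ B) (q : D ⥤ B) :
    HoSum (prodFamily (fibreFunctor p) (fibreFunctor q)) ⥤ C × D where
  obj X := (X.fiber.1.left, X.fiber.2.left)
  map f := (f.fiber.1.left, f.fiber.2.left)
  map_id X := by
    let F := prodFamily (fibreFunctor p) (fibreFunctor q)
    have h : (F.map (𝟙 X.base)).toFunctor.obj X.fiber = X.fiber :=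
      congrArg (fun k => Functor.obj (Cat.Hom.toFunctor k) X.fiber) (F.map_id X.base)
    have h' := prodFibre_eqToHom (p := p) (q := q) h
    exact Prod.ext h'.1 h'.2
  map_comp {X Y Z} f g := by
    let F := prodFamily (fibreFunctor p) (fibreFunctor q)
    have h : (F.map (f ≫ g).base).toFunctor.obj X.fiber =
        (F.map g.base).toFunctor.obj ((F.map f.base).toFunctor.obj X.fiber) :=
      congrArg (fun k => Functor.obj (Cat.Hom.toFunctor k) X.fiber) (F.map_comp f.base g.base)
    have h' := prodFibre_eqToHom (p := p) (q := q) h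
    refine Prod.ext ?_ ?_
    · exact (congrArg (· ≫ (f.fiber.1.left ≫ g.fiber.1.left)) h'.1).trans
        (Category.id_comp (f.fiber.1.left ≫ g.fiber.1.left))
    · exact (congrArg (· ≫ (f.fiber.2.left ≫ g.fiber.2.left)) h'.2).trans
        (Category.id_comp (f.fiber.2.left ≫ g.fiber.2.left))

/-- A finite family of objects of `C`; for a groupoid `C` this is a `C`-coloured finite set. -/
structure Fam (C : Type u) where
  /-- The finite indexing set. -/
  ι : Type
  [fin : Finite ι]
  /-- The members of the family. -/
  obj : ι → C

/-- An arrow between finite families: a bijection of indexing sets and arrows between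
corresponding members. -/
structure Fam.Hom {C : Type u} [Groupoid.{v} C] (X Y : Fam C) where
  /-- The bijection on indexing sets. -/
  e : X.ι ≃ Y.ι
  /-- The components (the 2-cell of the triangle). -/
  φ : ∀ i, X.obj i ⟶ Y.obj (e i)

theorem Fam.Hom.ext' {C : Type u} [Groupoid.{v} C] {X Y : Fam C} {f g : Fam.Hom X Y}
    (h : f.e = g.e) (h' : ∀ i, f.φ i ≫ eqToHom (by rw [h]) = g.φ i) : f = g := by
  obtain ⟨e, F⟩ := f
  obtain ⟨e', G⟩ := g
  obtain rfl : e = e' := h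
  obtain rfl : F = G := by
    funext i
    simpa using h' i
  rfl

theorem Fam.φ_eq {C : Type u} [Groupoid.{v} C] {X Y : Fam C} (f : Fam.Hom X Y) {i j : X.ι}
    (h : i = j) : f.φ j = eqToHom (by rw [h]) ≫ f.φ i ≫ eqToHom (by rw [h]) := by
  subst h
  simp

theorem Fam.inv_aux {C : Type u} [Groupoid.{v} C] {x y x' y' : C} (f : x ⟶ y) (h₁ : x = x')
    (h₂ : y = y') (h₃ : y = y') (h₄ : x' = x) :
    (f ≫ eqToHom h₃ ≫ Groupoid.inv (eqToHom h₁.symm ≫ f ≫ eqToHom h₂)) ≫ eqToHom h₄ = 𝟙 x := by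
  subst h₁ h₂
  simp

theorem Fam.inv_aux' {C : Type u} [Groupoid.{v} C] {x y z : C} (f : x ⟶ y) (h₁ : z = y)
    (h₂ : y = z) : ((eqToHom h₁ ≫ Groupoid.inv f) ≫ f) ≫ eqToHom h₂ = 𝟙 z := by
  subst h₂
  simp

/-- The groupoid of finite families of objects of the groupoid `C`. -/
instance Fam.groupoid {C : Type u} [Groupoid.{v} C] : Groupoid.{v} (Fam C) where
  Hom X Y := Fam.Hom X Y
  id X := ⟨Equiv.refl _, fun i => 𝟙 (X.obj i)⟩
  comp f g := ⟨f.e.trans g.e, fun i => f.φ i ≫ g.φ (f.e i)⟩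
  id_comp f := Fam.Hom.ext' rfl (fun i => by simp)
  comp_id f := Fam.Hom.ext' rfl (fun i => by simp)
  assoc f g h := Fam.Hom.ext' rfl (fun i => by simp)
  inv {X Y} f := ⟨f.e.symm, fun j =>
    eqToHom (by rw [Equiv.apply_symm_apply]) ≫ Groupoid.inv (f.φ (f.e.symm j))⟩
  inv_comp f := Fam.Hom.ext' (by ext; simp) (fun i => by
    exact Fam.inv_aux' (f.φ (f.e.symm i)) _ _)
  comp_inv {X Y} f := Fam.Hom.ext' (by ext; simp) (fun i => by
    have hs := (f.e.symm_apply_apply i).symm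
    have h := Fam.inv_aux (f.φ i) (congrArg X.obj hs) (congrArg (fun i => Y.obj (f.e i)) hs)
      (congrArg (fun i => Y.obj (f.e i)) hs) (congrArg X.obj hs).symm
    rw [← Fam.φ_eq f hs] at h
    exact h)

/-- A functor between groupoids induces a functor between groupoids of finite families. -/
@[simps]
def Fam.map {C : Type u₁} [Groupoid.{v₁} C] {D : Type u₂} [Groupoid.{v₂} D] (F : C ⥤ D) :
    Fam C ⥤ Fam D where
  obj X := { ι := X.ι, fin := X.fin, obj := fun i => F.obj (X.obj i) }
  map f := ⟨f.e, fun i => F.map (f.φ i)⟩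
  map_id X := Fam.Hom.ext' rfl (fun i => by
    change F.map (𝟙 _) ≫ 𝟙 _ = 𝟙 _
    simp)
  map_comp f g := Fam.Hom.ext' rfl (fun i => by
    change F.map (f.φ i ≫ g.φ (f.e i)) ≫ 𝟙 _ = F.map _ ≫ F.map _
    rw [Category.comp_id, F.map_comp])

end Groupoids

/-! ### Trees -/

/-- A diagram of sets `A ← M → N → A`. -/
structure Diagram where
  /-- edges -/
  A : Type
  /-- nodes with a marked input edge -/
  M : Type
  /-- nodes -/
  N : Type
  /-- the marked edge -/
  s : M → A
  /-- forget the marking -/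
  p : M → N
  /-- output edge of a node -/
  t : N → A

open Classical in
/-- The walk-to-the-root function: `s m ↦ t (p m)`, and the identity off the image of `s`. -/
noncomputable def Diagram.walk (D : Diagram) (x : D.A) : D.A :=
  if h : ∃ m, D.s m = x then D.t (D.p h.choose) else x

/-- A (finite rooted operadic) tree. -/
structure Tree extends Diagram where
  [finA : Finite A]
  [finM : Finite M]
  [finN : Finite N]
  t_inj : Function.Injective t
  s_inj : Function.Injective s
  /-- The root edge, the unique edge not in the image of `s`. -/
  root : A
  compl_range_s : (Set.range s)ᶜ = {root}
  reach : ∀ x, ∃ k : ℕ, toDiagram.walk^[k] x = root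

/-- A tree embedding: a morphism of diagrams whose middle square is cartesian. -/
@[ext]
structure Tree.Emb (S T : Tree) where
  /-- map on edges -/
  a : S.A → T.A
  /-- map on marked nodes -/
  m : S.M → T.M
  /-- map on nodes -/
  n : S.N → T.N
  s_comm : ∀ x, a (S.s x) = T.s (m x)
  p_comm : ∀ x, n (S.p x) = T.p (m x)
  t_comm : ∀ k, a (S.t k) = T.t (n k)
  cart : ∀ (k : S.N) (y : T.M), T.p y = n k → ∃! x : S.M, S.p x = k ∧ m x = y

namespace Tree

/-- The identity embedding. -/
abbrev Emb.id (T : Tree) : Emb T T where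
  a := _root_.id
  m := _root_.id
  n := _root_.id
  s_comm _ := rfl
  p_comm _ := rfl
  t_comm _ := rfl
  cart _ y h := ⟨y, ⟨h, rfl⟩, fun _ hz => hz.2⟩

/-- Composition of embeddings. -/
abbrev Emb.comp {S T U : Tree} (f : Emb S T) (g : Emb T U) : Emb S U where
  a := g.a ∘ f.a
  m := g.m ∘ f.m
  n := g.n ∘ f.n
  s_comm x := by simp [f.s_comm, g.s_comm]
  p_comm x := by simp [f.p_comm, g.p_comm]
  t_comm k := by simp [f.t_comm, g.t_comm]
  cart k y h := by
    obtain ⟨z, ⟨hz, rfl⟩, hz'⟩ := g.cart (f.n k) y h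
    obtain ⟨x, ⟨hx, rfl⟩, hx'⟩ := f.cart k z hz
    refine ⟨x, ⟨hx, rfl⟩, fun x' h' => hx' _ ⟨h'.1, hz' _ ⟨?_, h'.2⟩⟩⟩
    rw [← f.p_comm, h'.1]

variable (T : Tree)

/-- The leaves: the edges that are not the output edge of a node. -/
def Leaf : Type := {x : T.A // ∀ k, T.t k ≠ x}

instance : Finite T.Leaf :=
  have := T.finA
  inferInstanceAs (Finite {x : T.A // ∀ k, T.t k ≠ x})

/-- `T.Above e x`: the edge `x` lies above (or is equal to) the edge `e`. -/
inductive Above (e : T.A) : T.A → Prop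
  | refl : Above e e
  | step (m : T.M) : Above e (T.t (T.p m)) → Above e (T.s m)

variable {T}

theorem walk_s (m : T.M) : T.walk (T.s m) = T.t (T.p m) := by
  have h : ∃ m', T.s m' = T.s m := ⟨m, rfl⟩
  rw [Diagram.walk, dif_pos h, T.s_inj h.choose_spec]

theorem s_ne_root (m : T.M) : T.s m ≠ T.root := by
  intro h
  have : T.s m ∈ (Set.range T.s)ᶜ := by rw [T.compl_range_s, h]; rfl
  exact this ⟨m, rfl⟩

theorem eq_root_or (x : T.A) : x = T.root ∨ ∃ m, T.s m = x := by
  by_cases h : ∃ m, T.s m = x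
  · exact Or.inr h
  · have : x ∈ (Set.range T.s)ᶜ := fun ⟨m, hm⟩ => h ⟨m, hm⟩
    rw [T.compl_range_s] at this
    exact Or.inl this

theorem walk_root : T.walk T.root = T.root := by
  rw [Diagram.walk, dif_neg]
  rintro ⟨m, hm⟩
  exact s_ne_root m hm

/-- Induction from the root upwards. -/
theorem root_induction {Q : T.A → Prop} (h₀ : Q T.root)
    (h₁ : ∀ m, Q (T.t (T.p m)) → Q (T.s m)) (x : T.A) : Q x := by
  obtain ⟨k, hk⟩ := T.reach x
  induction k generalizing x with
  | zero => exact (show x = T.root from hk) ▸ h₀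
  | succ k ih =>
    rcases eq_root_or x with rfl | ⟨m, rfl⟩
    · exact h₀
    · rw [Function.iterate_succ_apply, walk_s] at hk
      exact h₁ m (ih _ hk)

theorem Above.exists_walk {e x : T.A} (h : T.Above e x) : ∃ k : ℕ, T.walk^[k] x = e := by
  induction h with
  | refl => exact ⟨0, rfl⟩
  | step m _ ih =>
    obtain ⟨k, hk⟩ := ih
    exact ⟨k + 1, by rw [Function.iterate_succ_apply, walk_s, hk]⟩

theorem not_above_s (m : T.M) : ¬ T.Above (T.s m) (T.t (T.p m)) := by
  intro h
  obtain ⟨k, hk⟩ := h.exists_walk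
  rw [← walk_s, ← Function.iterate_succ_apply] at hk
  obtain ⟨K, hK⟩ := T.reach (T.s m)
  have h1 : (T.walk^[k + 1])^[K] (T.s m) = T.s m := Function.iterate_fixed hk K
  rw [← Function.iterate_mul, show (k + 1) * K = k * K + K by ring,
    Function.iterate_add_apply, hK, Function.iterate_fixed walk_root] at h1
  exact s_ne_root m h1.symm

/-- The ideal subtree generated by the edge `e`: all edges and nodes above `e`. -/
abbrev ideal (T : Tree) (e : T.A) : Tree where
  A := {x : T.A // T.Above e x}
  M := {m : T.M // T.Above e (T.t (T.p m))}
  N := {k : T.N // T.Above e (T.t k)}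
  s m := ⟨T.s m.1, .step m.1 m.2⟩
  p m := ⟨T.p m.1, m.2⟩
  t k := ⟨T.t k.1, k.2⟩
  finA := have := T.finA; inferInstance
  finM := have := T.finM; inferInstance
  finN := have := T.finN; inferInstance
  t_inj k k' h := Subtype.ext (T.t_inj (congrArg Subtype.val h))
  s_inj m m' h := Subtype.ext (T.s_inj (congrArg Subtype.val h))
  root := ⟨e, .refl⟩
  compl_range_s := by
    ext ⟨x, hx⟩
    simp only [Set.mem_compl_iff, Set.mem_range, Set.mem_singleton_iff, Subtype.mk.injEq]
    constructor
    · intro h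
      cases hx with
      | refl => rfl
      | step m hm => exact absurd ⟨⟨m, hm⟩, rfl⟩ h
    · rintro h' ⟨⟨m, hm⟩, h⟩
      refine not_above_s m ?_
      rw [show T.s m = e from h.trans h']
      exact hm
  reach := by
    rintro ⟨x, hx⟩
    induction hx with
    | refl => exact ⟨0, rfl⟩
    | step m hm ih =>
      obtain ⟨k, hk⟩ := ih
      refine ⟨k + 1, ?_⟩
      rw [Function.iterate_succ_apply, ← hk]
      congr 1
      rw [Diagram.walk]
      have h : ∃ m' : {m : T.M // T.Above e (T.t (T.p m))},
          (⟨T.s m'.1, .step m'.1 m'.2⟩ : {x : T.A // T.Above e x}) = ⟨T.s m, .step m hm⟩ :=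
        ⟨⟨m, hm⟩, rfl⟩
      rw [dif_pos h]
      have h' : h.choose.1 = m := T.s_inj (congrArg Subtype.val h.choose_spec)
      apply Subtype.ext
      exact congrArg (fun m => T.t (T.p m)) h'

theorem Above.map {S T : Tree} (f : Emb S T) {e x : S.A} (h : S.Above e x) :
    T.Above (f.a e) (f.a x) := by
  induction h with
  | refl => exact .refl
  | step m _ ih =>
    rw [f.s_comm]
    rw [f.t_comm, f.p_comm] at ih
    exact .step _ ih

/-- An embedding sending `e` to `e'` restricts to the ideal subtrees generated by `e` and `e'`. -/
abbrev Emb.ideal {S T : Tree} (f : Emb S T) {e : S.A} {e' : T.A} (h : f.a e = e') :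
    Emb (S.ideal e) (T.ideal e') where
  a x := ⟨f.a x.1, h ▸ x.2.map f⟩
  m x := ⟨f.m x.1, by
    have := x.2.map f
    rwa [h, f.t_comm, f.p_comm] at this⟩
  n x := ⟨f.n x.1, by
    have := x.2.map f
    rwa [h, f.t_comm] at this⟩
  s_comm x := Subtype.ext (f.s_comm x.1)
  p_comm x := Subtype.ext (f.p_comm x.1)
  t_comm x := Subtype.ext (f.t_comm x.1)
  cart k y h := by
    obtain ⟨x, ⟨hx, hxy⟩, hx'⟩ := f.cart k.1 y.1 (congrArg Subtype.val h)
    refine ⟨⟨x, by rw [hx]; exact k.2⟩, ⟨Subtype.ext hx, Subtype.ext hxy⟩, fun z hz => ?_⟩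
    exact Subtype.ext (hx' z.1 ⟨congrArg Subtype.val hz.1, congrArg Subtype.val hz.2⟩)

/-- Root-preserving embeddings are injective on edges. -/
theorem Emb.a_injective {S T : Tree} (f : Emb S T) (hf : f.a S.root = T.root) :
    Function.Injective f.a := by
  intro x
  induction x using root_induction with
  | h₀ =>
    intro y h
    rcases eq_root_or y with rfl | ⟨m, rfl⟩
    · rfl
    · rw [hf, f.s_comm] at h
      exact absurd h.symm (s_ne_root _)
  | h₁ m ih =>
    intro y h
    rcases eq_root_or y with rfl | ⟨m', rfl⟩
    · rw [hf, f.s_comm] at h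
      exact absurd h (s_ne_root _)
    · rw [f.s_comm, f.s_comm] at h
      have h1 : f.m m = f.m m' := T.s_inj h
      have h2 : S.p m = S.p m' := S.t_inj (ih (by
        rw [f.t_comm, f.t_comm, f.p_comm, f.p_comm, h1]))
      have h3 := (f.cart (S.p m') (f.m m') (f.p_comm m').symm).unique ⟨h2, h1⟩ ⟨rfl, rfl⟩
      rw [h3]

end Tree

/-! ### Decorated trees -/

/-- A diagram of groupoids `I ← E → B → I`, representing a polynomial endofunctor. -/
structure PolyEndo (I : Type u₁) (E : Type u₂) (B : Type u₃)
    [Groupoid.{v₁} I] [Groupoid.{v₂} E] [Groupoid.{v₃} B] where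
  /-- the left leg -/
  s : E ⥤ I
  /-- the middle map -/
  p : E ⥤ B
  /-- the right leg -/
  t : B ⥤ I

section Decorated

variable {I : Type u₁} {E : Type u₂} {B : Type u₃}
  [Groupoid.{v₁} I] [Groupoid.{v₂} E] [Groupoid.{v₃} B]

/-- For a square with sides `p : M → N` and `q : E ⥤ B` that commutes up to the isomorphisms `θ`
(where the sets `M` and `N` are regarded as discrete groupoids), the comparison functor to the
homotopy pullback. -/
def comparison (q : E ⥤ B) {M N : Type} (p : M → N) (β : M → E) (γ : N → B)
    (θ : ∀ m, q.obj (β m) ⟶ γ (p m)) :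
    Discrete M ⥤ HPullback q (Discrete.functor γ) :=
  Discrete.functor fun m =>
    { left := β m
      right := ⟨p m⟩
      hom := θ m }

/-- Elementary criterion for such a square to be a homotopy pullback. -/
theorem comparison_isEquivalence_iff (q : E ⥤ B) {M N : Type} (p : M → N) (β : M → E) (γ : N → B)
    (θ : ∀ m, q.obj (β m) ⟶ γ (p m)) :
    (comparison q p β γ θ).IsEquivalence ↔
      ∀ (n : N) (e : E) (φ : q.obj e ⟶ γ n), ∃! x : Σ m, (e ⟶ β m),
        (⟨p x.1, q.map x.2 ≫ θ x.1⟩ : Σ n, (q.obj e ⟶ γ n)) = ⟨n, φ⟩ := by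
  constructor
  · intro h n e φ
    refine existsUnique_of_exists_of_unique ?_ ?_
    · let X : HPullback q (Discrete.functor γ) := { left := e, right := ⟨n⟩, hom := φ }
      obtain ⟨⟨m⟩, ⟨i⟩⟩ := h.essSurj.mem_essImage X
      have hn : n = p m := Discrete.eq_of_hom i.inv.right
      subst hn
      refine ⟨⟨m, i.inv.left⟩, ?_⟩
      have hw := i.inv.w
      have hr : i.inv.right = 𝟙 _ := Subsingleton.elim _ _
      rw [hr] at hw
      replace hw : q.map i.inv.left ≫ θ m = φ :=
        hw.trans ((congrArg (φ ≫ ·) ((Discrete.functor γ).map_id _)).trans (Category.comp_id φ))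
      exact congrArg (fun z => (⟨p m, z⟩ : Σ n, (q.obj e ⟶ γ n))) hw
    · rintro ⟨m, f⟩ ⟨m', f'⟩ h1 h2
      have h3 := h1.trans h2.symm
      dsimp only at h3
      rw [Sigma.mk.injEq] at h3
      obtain ⟨h3, h4⟩ := h3
      let g : (comparison q p β γ θ).obj ⟨m⟩ ⟶ (comparison q p β γ θ).obj ⟨m'⟩ :=
        { left := (Groupoid.inv f ≫ f' : β m ⟶ β m')
          right := Discrete.eqToHom h3
          w := by
            change q.map (Groupoid.inv f ≫ f') ≫ θ m' =
              θ m ≫ (Discrete.functor γ).map (Discrete.eqToHom h3)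
            have h5 : q.map f ≫ θ m ≫ (Discrete.functor γ).map (Discrete.eqToHom h3) =
                q.map f' ≫ θ m' := by
              generalize θ m = a at *
              generalize θ m' = b at *
              generalize p m = x at *
              generalize p m' = y at *
              subst h3
              simpa using eq_of_heq h4
            rw [q.map_comp, Category.assoc, ← h5, ← q.map_comp_assoc]
            simp }
      obtain ⟨k, hk⟩ := h.full.map_surjective g
      have hm : m = m' := Discrete.eq_of_hom k
      subst hm
      have hk' : k = 𝟙 _ := Subsingleton.elim _ _
      rw [hk'] at hk
      have h6 : 𝟙 (β m) = Groupoid.inv f ≫ f' :=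
        congrArg CommaMorphism.left (((comparison q p β γ θ).map_id _).symm.trans hk)
      have h7 : f' = f := by
        have := congrArg (fun z => f ≫ z) h6
        simpa using this.symm
      rw [h7]
  · intro h
    have hfaith : (comparison q p β γ θ).Faithful := ⟨fun _ => Subsingleton.elim _ _⟩
    have hfull : (comparison q p β γ θ).Full := by
      constructor
      rintro ⟨m⟩ ⟨m'⟩ g
      have hp : p m = p m' := Discrete.eq_of_hom g.right
      obtain ⟨l, hl⟩ : ∃ l : β m ⟶ β m', l = g.left := ⟨_, rfl⟩
      have hw : q.map l ≫ θ m' = θ m ≫ (Discrete.functor γ).map (Discrete.eqToHom hp) := by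
        rw [hl]
        exact g.w
      have hw' : (⟨p m, q.map (𝟙 (β m)) ≫ θ m⟩ : Σ n, (q.obj (β m) ⟶ γ n)) =
          ⟨p m', q.map l ≫ θ m'⟩ := by
        rw [hw]
        generalize θ m = a
        clear hw hl g
        generalize p m = x at *
        generalize p m' = y at *
        subst hp
        simp
      have key : (⟨m, 𝟙 (β m)⟩ : Σ m', (β m ⟶ β m')) = ⟨m', l⟩ :=
        (h (p m') (β m) (q.map l ≫ θ m')).unique hw' rfl
      rw [Sigma.mk.injEq] at key
      obtain ⟨hm, hg⟩ := key
      subst hm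
      refine ⟨𝟙 _, ((comparison q p β γ θ).map_id _).trans ?_⟩
      apply CommaMorphism.ext
      · exact (eq_of_heq hg).trans hl
      · exact Subsingleton.elim _ _
    have hess : (comparison q p β γ θ).EssSurj := by
      constructor
      rintro ⟨e, ⟨n⟩, φ⟩
      obtain ⟨⟨m, f⟩, hx, -⟩ := h n e φ
      dsimp only at hx
      rw [Sigma.mk.injEq] at hx
      obtain ⟨rfl, hx⟩ := hx
      refine ⟨⟨m⟩, ⟨Iso.symm (Comma.isoMk ((Groupoid.isoEquivHom _ _).symm f) (Iso.refl _) ?_)⟩⟩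
      change q.map f ≫ θ m = φ ≫ (Discrete.functor γ).map (𝟙 _)
      rw [eq_of_heq hx]
      exact ((congrArg (φ ≫ ·) ((Discrete.functor γ).map_id _)).trans (Category.comp_id φ)).symm
    exact { }

/-- A `P`-tree: a tree with a map of diagrams to `P`, commuting up to specified isomorphisms,
whose middle square is a homotopy pullback. -/
structure PTree (P : PolyEndo I E B) extends Tree where
  /-- decoration of edges -/
  α : A → I
  /-- decoration of marked nodes -/
  β : M → E
  /-- decoration of nodes -/
  γ : N → B
  /-- the 2-cell of the left-hand square -/
  sIso : ∀ m, P.s.obj (β m) ⟶ α (s m)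
  /-- the 2-cell of the middle square -/
  pIso : ∀ m, P.p.obj (β m) ⟶ γ (p m)
  /-- the 2-cell of the right-hand square -/
  tIso : ∀ k, P.t.obj (γ k) ⟶ α (t k)
  pcart : (comparison P.p p β γ pIso).IsEquivalence

variable {P : PolyEndo I E B}

/-- An embedding of `P`-trees: an arrow in the (weak) slice over `P` of the category of tree
embeddings, i.e. an embedding together with 2-cells that are compatible with those of
the squares. -/
structure PTree.Hom (S T : PTree P) extends Tree.Emb S.toTree T.toTree where
  /-- 2-cell on edges -/
  ha : ∀ x, S.α x ⟶ T.α (a x)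
  /-- 2-cell on marked nodes -/
  hm : ∀ x, S.β x ⟶ T.β (m x)
  /-- 2-cell on nodes -/
  hn : ∀ k, S.γ k ⟶ T.γ (n k)
  sq_s : ∀ x, S.sIso x ≫ ha (S.s x) ≫ eqToHom (congrArg T.α (s_comm x)) =
    P.s.map (hm x) ≫ T.sIso (m x)
  sq_p : ∀ x, S.pIso x ≫ hn (S.p x) ≫ eqToHom (congrArg T.γ (p_comm x)) =
    P.p.map (hm x) ≫ T.pIso (m x)
  sq_t : ∀ k, S.tIso k ≫ ha (S.t k) ≫ eqToHom (congrArg T.α (t_comm k)) =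
    P.t.map (hn k) ≫ T.tIso (n k)

namespace PTree

theorem Hom.ext' {S T : PTree P} {f g : Hom S T} (h : f.toEmb = g.toEmb)
    (h₁ : ∀ x, f.ha x ≫ eqToHom (by rw [h]) = g.ha x)
    (h₂ : ∀ x, f.hm x ≫ eqToHom (by rw [h]) = g.hm x)
    (h₃ : ∀ x, f.hn x ≫ eqToHom (by rw [h]) = g.hn x) : f = g := by
  obtain ⟨f, fa, fm, fn, _, _, _⟩ := f
  obtain ⟨g, ga, gm, gn, _, _, _⟩ := g
  obtain rfl : f = g := h
  obtain rfl : fa = ga := by funext x; simpa using h₁ x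
  obtain rfl : fm = gm := by funext x; simpa using h₂ x
  obtain rfl : fn = gn := by funext x; simpa using h₃ x
  rfl

theorem naturality_aux {C : Type u} [Category.{v} C] {X Y : Type} {F : X → C} {G : Y → C}
    {k : X → Y} (h : ∀ x, F x ⟶ G (k x)) {x y : X} (e : x = y) :
    eqToHom (congrArg F e) ≫ h y = h x ≫ eqToHom (congrArg (fun z => G (k z)) e) := by
  subst e
  simp

theorem paste_aux {C : Type u} [Category.{v} C] {A₁ A₂ A₃ A₄ A₅ B₁ B₂ C₁ C₂ : C}
    {σ : A₁ ⟶ A₂} {f : A₂ ⟶ A₃} {e₁ : A₃ ⟶ B₁} {k : A₁ ⟶ B₂} {τ : B₂ ⟶ B₁}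
    {g' : B₁ ⟶ C₁} {e₂ : C₁ ⟶ C₂} {k' : B₂ ⟶ A₄} {υ : A₄ ⟶ C₂} {g : A₃ ⟶ A₅} {e₃ : A₅ ⟶ C₁}
    {e₄ : A₅ ⟶ C₂} (h₁ : σ ≫ f ≫ e₁ = k ≫ τ) (h₂ : τ ≫ g' ≫ e₂ = k' ≫ υ)
    (h₃ : e₁ ≫ g' = g ≫ e₃) (h₄ : e₃ ≫ e₂ = e₄) :
    σ ≫ (f ≫ g) ≫ e₄ = (k ≫ k') ≫ υ := by
  rw [Category.assoc k, ← h₂, ← reassoc_of% h₁, reassoc_of% h₃, h₄, Category.assoc]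

/-- The identity embedding of a `P`-tree. -/
abbrev Hom.id (T : PTree P) : Hom T T where
  toEmb := Tree.Emb.id T.toTree
  ha x := 𝟙 (T.α x)
  hm x := 𝟙 (T.β x)
  hn x := 𝟙 (T.γ x)
  sq_s x := by simp
  sq_p x := by simp
  sq_t x := by simp

/-- Composition of embeddings of `P`-trees. -/
abbrev Hom.comp {S T U : PTree P} (f : Hom S T) (g : Hom T U) : Hom S U where
  toEmb := f.toEmb.comp g.toEmb
  ha x := f.ha x ≫ g.ha (f.a x)
  hm x := f.hm x ≫ g.hm (f.m x)
  hn x := f.hn x ≫ g.hn (f.n x)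
  sq_s x := (paste_aux (f.sq_s x) (g.sq_s (f.m x)) (naturality_aux g.ha (f.s_comm x))
      (eqToHom_trans _ _)).trans (congrArg (· ≫ U.sIso _) (P.s.map_comp _ _).symm)
  sq_p x := (paste_aux (f.sq_p x) (g.sq_p (f.m x)) (naturality_aux g.hn (f.p_comm x))
      (eqToHom_trans _ _)).trans (congrArg (· ≫ U.pIso _) (P.p.map_comp _ _).symm)
  sq_t x := (paste_aux (f.sq_t x) (g.sq_t (f.n x)) (naturality_aux g.ha (f.t_comm x))
      (eqToHom_trans _ _)).trans (congrArg (· ≫ U.tIso _) (P.t.map_comp _ _).symm)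

/-- The category of `P`-trees and their embeddings. -/
instance : Category (PTree P) where
  Hom S T := Hom S T
  id T := Hom.id T
  comp f g := Hom.comp f g
  id_comp f := Hom.ext' rfl (fun x => by simp [Hom.comp, Hom.id])
    (fun x => by simp [Hom.comp, Hom.id]) (fun x => by simp [Hom.comp, Hom.id])
  comp_id f := Hom.ext' rfl (fun x => by simp [Hom.comp, Hom.id])
    (fun x => by simp [Hom.comp, Hom.id]) (fun x => by simp [Hom.comp, Hom.id])
  assoc f g h := Hom.ext' rfl (fun x => by simp [Hom.comp])
    (fun x => by simp [Hom.comp]) (fun x => by simp [Hom.comp])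

@[simp] theorem comp_a {S T U : PTree P} (f : S ⟶ T) (g : T ⟶ U) (x : S.A) :
    (f ≫ g).a x = g.a (f.a x) := rfl

@[simp] theorem id_a (T : PTree P) (x : T.A) : (𝟙 T : T ⟶ T).a x = x := rfl

theorem congr_a {S T : PTree P} {f g : S ⟶ T} (h : f = g) (x : S.A) : f.a x = g.a x := by
  rw [h]

theorem iso_hom_inv_a {S T : PTree P} (f : S ≅ T) (x : S.A) : f.inv.a (f.hom.a x) = x :=
  congr_a f.hom_inv_id x

theorem iso_inv_hom_a {S T : PTree P} (f : S ≅ T) (x : T.A) : f.hom.a (f.inv.a x) = x :=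
  congr_a f.inv_hom_id x

theorem iso_root {S T : PTree P} (f : S ≅ T) : f.hom.a S.root = T.root := by
  rcases Tree.eq_root_or (f.hom.a S.root) with h | ⟨m, h⟩
  · exact h
  · have h1 := iso_hom_inv_a f S.root
    rw [← h, f.inv.s_comm] at h1
    exact absurd h1 (Tree.s_ne_root _)

theorem iso_leaf {S T : PTree P} (f : S ≅ T) {x : S.A} (hx : ∀ k, S.t k ≠ x) (k : T.N) :
    T.t k ≠ f.hom.a x := by
  intro h
  apply hx (f.inv.n k)
  rw [← f.inv.t_comm, h, iso_hom_inv_a]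

/-- The bijection on leaves induced by an isomorphism of `P`-trees. -/
@[simps]
def leafEquiv {S T : PTree P} (f : S ≅ T) : S.Leaf ≃ T.Leaf where
  toFun x := ⟨f.hom.a x.1, iso_leaf f x.2⟩
  invFun x := ⟨f.inv.a x.1, iso_leaf f.symm x.2⟩
  left_inv x := Subtype.ext (iso_hom_inv_a f x.1)
  right_inv x := Subtype.ext (iso_inv_hom_a f x.1)

/-- The ideal subtree of a `P`-tree generated by an edge, with the restricted decorations. -/
def ideal (T : PTree P) (e : T.A) : PTree P where
  toTree := T.toTree.ideal e
  α x := T.α x.1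
  β x := T.β x.1
  γ x := T.γ x.1
  sIso x := T.sIso x.1
  pIso x := T.pIso x.1
  tIso x := T.tIso x.1
  pcart := by
    refine (comparison_isEquivalence_iff _ _ _ _ _).2 ?_
    intro k c φ
    have hT := (comparison_isEquivalence_iff _ _ _ _ _).1 T.pcart k.1 c φ
    obtain ⟨⟨m, f⟩, hx, hx'⟩ := hT
    dsimp only at hx
    rw [Sigma.mk.injEq] at hx
    obtain ⟨k, hk⟩ := k
    obtain ⟨hx1, hx2⟩ := hx
    dsimp only at hx1
    subst hx1
    refine ⟨⟨⟨m, hk⟩, f⟩, ?_, ?_⟩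
    · exact congrArg (fun z => (⟨⟨T.p m, hk⟩, z⟩ :
        Σ n : (T.toTree.ideal e).N, (P.p.obj c ⟶ T.γ n.1))) (eq_of_heq hx2)
    · rintro ⟨⟨m', hm'⟩, f'⟩ h
      rw [Sigma.mk.injEq] at h
      obtain ⟨h1, h2⟩ := h
      have h1' : T.p m' = T.p m := congrArg Subtype.val h1
      have h3 : (⟨m', f'⟩ : Σ m, (c ⟶ T.β m)) = ⟨m, f⟩ := by
        apply hx'
        rw [Sigma.mk.injEq]
        exact ⟨h1', h2⟩
      rw [Sigma.mk.injEq] at h3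
      obtain ⟨rfl, h3⟩ := h3
      rw [eq_of_heq h3]

/-- An embedding sending `e` to `e'` restricts to the ideal subtrees generated by `e` and `e'`. -/
def Hom.ideal {S T : PTree P} (f : S ⟶ T) {e : S.A} {e' : T.A} (h : f.a e = e') :
    S.ideal e ⟶ T.ideal e' :=
  { toEmb := f.toEmb.ideal h
    ha := fun x => f.ha x.1
    hm := fun x => f.hm x.1
    hn := fun x => f.hn x.1
    sq_s := fun x => f.sq_s x.1
    sq_p := fun x => f.sq_p x.1
    sq_t := fun x => f.sq_t x.1 : Hom (S.ideal e) (T.ideal e') }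

theorem Hom.ideal_congr {S T : PTree P} {f g : S ⟶ T} (hfg : f = g) {e : S.A} {e' : T.A}
    (h : f.a e = e') (h' : g.a e = e') : Hom.ideal f h = Hom.ideal g h' := by
  subst hfg
  rfl

/-- The isomorphism of ideal subtrees induced by an isomorphism of `P`-trees. -/
@[simps]
def idealIso {S T : PTree P} (f : S ≅ T) {e : S.A} {e' : T.A} (h : f.hom.a e = e') :
    S.ideal e ≅ T.ideal e' where
  hom := Hom.ideal f.hom h
  inv := Hom.ideal f.inv (by rw [← h, iso_hom_inv_a])
  hom_inv_id := Hom.ideal_congr f.hom_inv_id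
    (show (f.hom ≫ f.inv).a e = e from iso_hom_inv_a f e) rfl
  inv_hom_id := Hom.ideal_congr f.inv_hom_id
    (show (f.inv ≫ f.hom).a e' = e' from iso_inv_hom_a f e') rfl

end PTree

/-! ### The groupoids of trees, forests, and trees with a cut -/

variable (P)

/-- The groupoid `T` of `P`-trees and their isomorphisms. -/
abbrev Trees := Core (PTree P)

/-- The groupoid `F` of `P`-forests: finite families of `P`-trees. -/
abbrev Forests := Fam (Trees P)

/-- The leaf map `L : T ⥤ fam I`. -/
@[simps]
def leafMap : Trees P ⥤ Fam I where
  obj T := { ι := T.of.Leaf, obj := fun x => T.of.α x.1 }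
  map f := ⟨PTree.leafEquiv f.iso, fun x => f.iso.hom.ha x.1⟩
  map_id _ := Fam.Hom.ext' rfl (fun _ => Category.comp_id _)
  map_comp _ _ := Fam.Hom.ext' rfl (fun _ => Category.comp_id _)

/-- The root map `R : T ⥤ I`. -/
@[simps]
def treeRootMap : Trees P ⥤ I where
  obj T := T.of.α T.of.root
  map {S T} f := f.iso.hom.ha S.of.root ≫ eqToHom (congrArg T.of.α (PTree.iso_root f.iso))
  map_id T := Category.comp_id _
  map_comp {S T U} f g := by
    have h := PTree.naturality_aux g.iso.hom.ha (PTree.iso_root f.iso)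
    change (f.iso.hom.ha S.of.root ≫ g.iso.hom.ha (f.iso.hom.a S.of.root)) ≫ eqToHom _ = _
    rw [Category.assoc, Category.assoc, reassoc_of% h, eqToHom_trans]

/-- The root map `R : F ⥤ fam I`. -/
abbrev forestRootMap : Forests P ⥤ Fam I := Fam.map (treeRootMap P)

/-- A `P`-tree with a cut: a root-preserving embedding of `P`-trees. -/
structure CutTree where
  /-- the subtree below the cut -/
  S : PTree P
  /-- the total tree -/
  T : PTree P
  /-- the embedding -/
  c : S ⟶ T
  root_pres : c.a S.root = T.root

variable {P}

/-- An arrow between trees with a cut: an isomorphism of root-preserving embeddings. -/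
@[ext]
structure CutTree.Hom (X Y : CutTree P) where
  /-- isomorphism of the subtrees -/
  σ : X.S ≅ Y.S
  /-- isomorphism of the total trees -/
  τ : X.T ≅ Y.T
  comm : X.c ≫ τ.hom = σ.hom ≫ Y.c

/-- The groupoid `C` of `P`-trees with a cut. -/
instance : Groupoid (CutTree P) where
  Hom X Y := CutTree.Hom X Y
  id X := ⟨Iso.refl _, Iso.refl _, by simp⟩
  comp f g := ⟨f.σ ≪≫ g.σ, f.τ ≪≫ g.τ, by
    rw [Iso.trans_hom, Iso.trans_hom, reassoc_of% f.comm, g.comm, Category.assoc]⟩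
  id_comp f := CutTree.Hom.ext (Iso.refl_trans _) (Iso.refl_trans _)
  comp_id f := CutTree.Hom.ext (Iso.trans_refl _) (Iso.trans_refl _)
  assoc f g h := CutTree.Hom.ext (Iso.trans_assoc _ _ _) (Iso.trans_assoc _ _ _)
  inv f := ⟨f.σ.symm, f.τ.symm, by
    rw [Iso.symm_hom, Iso.symm_hom, Iso.comp_inv_eq, Category.assoc, f.comm,
      Iso.inv_hom_id_assoc]⟩
  inv_comp f := CutTree.Hom.ext (Iso.symm_self_id _) (Iso.symm_self_id _)
  comp_inv f := CutTree.Hom.ext (Iso.self_symm_id _) (Iso.self_symm_id _)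

variable (P)

/-- `m : C ⥤ T`, the total tree. -/
@[simps]
def totalTree : CutTree P ⥤ Trees P where
  obj X := ⟨X.T⟩
  map f := ⟨f.τ⟩
  map_id _ := rfl
  map_comp _ _ := rfl

/-- `r : C ⥤ T`, the tree `S_c` below the cut. -/
@[simps]
def lowerTree : CutTree P ⥤ Trees P where
  obj X := ⟨X.S⟩
  map f := ⟨f.σ⟩
  map_id _ := rfl
  map_comp _ _ := rfl

/-- `w : C ⥤ F`, the forest `P_c` above the cut: the family, indexed by the leaves of `S_c`, of
the ideal subtrees of the total tree that they generate. -/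
@[simps]
def upperForest : CutTree P ⥤ Forests P where
  obj X := { ι := X.S.Leaf, obj := fun x => ⟨X.T.ideal (X.c.a x.1)⟩ }
  map f := ⟨PTree.leafEquiv f.σ, fun x => ⟨PTree.idealIso f.τ (PTree.congr_a f.comm x.1)⟩⟩
  map_id _ := Fam.Hom.ext' rfl (fun _ => Category.comp_id _)
  map_comp _ _ := Fam.Hom.ext' rfl (fun _ => Category.comp_id _)

/-- The functor `T ↦ cut(T)`: the discrete groupoid on the set `π₀` of components of the homotopy
fibre over `T` of the total tree functor `m : C ⥤ T`. -/
abbrev cut : Trees P ⥤ Cat :=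
  fibreFunctor (totalTree P) ⋙ Cat.connectedComponents ⋙ typeToCat

/-- The canonical functor from the homotopy sum of the homotopy fibres of `m : C ⥤ T` to the
homotopy sum of their sets of components. -/
def cutComponent : HoSum (fibreFunctor (totalTree P)) ⥤ HoSum (cut P) where
  obj X := ⟨X.base, ⟨Quotient.mk _ X.fiber⟩⟩
  map f := ⟨f.base, Discrete.eqToHom (Quotient.sound (Zigzag.of_hom f.fiber))⟩
  map_id _ := Grothendieck.ext _ _ rfl (Subsingleton.elim (α := (_ : Discrete _) ⟶ _) _ _)
  map_comp _ _ := Grothendieck.ext _ _ rfl (Subsingleton.elim (α := (_ : Discrete _) ⟶ _) _ _)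

variable {P}

/-- Root-preserving embeddings of `P`-trees are monomorphisms. -/
theorem PTree.cancel_root_pres {S T U : PTree P} {c : T ⟶ U} (hc : c.a T.root = U.root)
    {f g : S ⟶ T} (h : f ≫ c = g ≫ c) : f = g := by
  have ha : f.a = g.a := funext fun x => Tree.Emb.a_injective c.toEmb hc (congr_a h x)
  have hn : f.n = g.n := funext fun k => T.t_inj (by rw [← f.t_comm, ← g.t_comm, ha])
  have hm : f.m = g.m := funext fun k => T.s_inj (by rw [← f.s_comm, ← g.s_comm, ha])
  have he : f.toEmb = g.toEmb := Tree.Emb.ext ha hm hn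
  obtain ⟨f, fa, fm, fn, _, _, _⟩ := f
  obtain ⟨g, ga, gm, gn, _, _, _⟩ := g
  obtain rfl : f = g := he
  have key : ∀ {f g : S ⟶ U} (h : f = g),
      (∀ x, f.ha x ≫ eqToHom (by rw [h]) = g.ha x) ∧
      (∀ x, f.hm x ≫ eqToHom (by rw [h]) = g.hm x) ∧
      (∀ x, f.hn x ≫ eqToHom (by rw [h]) = g.hn x) := by
    rintro f _ rfl
    simp
  obtain ⟨h₁, h₂, h₃⟩ := key h
  obtain rfl : fa = ga := by
    funext x
    have := h₁ x
    rw [eqToHom_refl] at this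
    exact (cancel_mono (c.ha (f.a x))).1 ((Category.comp_id _).symm.trans this)
  obtain rfl : fm = gm := by
    funext x
    have := h₂ x
    rw [eqToHom_refl] at this
    exact (cancel_mono (c.hm (f.m x))).1 ((Category.comp_id _).symm.trans this)
  obtain rfl : fn = gn := by
    funext x
    have := h₃ x
    rw [eqToHom_refl] at this
    exact (cancel_mono (c.hn (f.n x))).1 ((Category.comp_id _).symm.trans this)
  rfl

/-- An isomorphism of trees with a cut is determined by its effect on the total tree. -/
theorem CutTree.hom_ext_of_total {X Y : CutTree P} {f g : X ⟶ Y}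
    (h : f.τ = g.τ) : f = g := by
  refine CutTree.Hom.ext (Iso.ext (PTree.cancel_root_pres Y.root_pres ?_)) h
  rw [← f.comm, ← g.comm, h]

/-- The homotopy fibres of `m : C ⥤ T` are discrete. -/
theorem fibre_totalTree_subsingleton {T : Trees P} (X Y : HFibre (totalTree P) T) :
    Subsingleton (X ⟶ Y) := by
  refine ⟨fun f g => CostructuredArrow.hom_ext _ _ (CutTree.hom_ext_of_total ?_)⟩
  have h : (totalTree P).map f.left = (totalTree P).map g.left := by
    rw [← cancel_mono Y.hom, CostructuredArrow.w, CostructuredArrow.w]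
  exact congrArg CoreHom.iso h

theorem nonempty_hom_of_zigzag {T : Trees P} {X Y : HFibre (totalTree P) T} (h : Zigzag X Y) :
    Nonempty (X ⟶ Y) := by
  induction h with
  | refl => exact ⟨𝟙 _⟩
  | tail _ h ih =>
    obtain ⟨f⟩ := ih
    rcases h with ⟨⟨g⟩⟩ | ⟨⟨g⟩⟩
    · exact ⟨f ≫ g⟩
    · refine ⟨f ≫ CostructuredArrow.homMk (Groupoid.inv g.left) ?_⟩
      rw [← CostructuredArrow.w g, ← Functor.map_comp_assoc]
      simp

variable (P)

instance : (cutComponent P).IsEquivalence where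
  faithful := ⟨fun {X Y} f g h => by
    have hb : f.base = g.base :=
      congrArg (fun k : (cutComponent P).obj X ⟶ (cutComponent P).obj Y => k.base) h
    exact Grothendieck.ext _ _ hb ((fibre_totalTree_subsingleton _ _).elim _ _)⟩
  full := ⟨fun {X Y} g => by
    have h := Discrete.eq_of_hom g.fiber
    obtain ⟨f⟩ := nonempty_hom_of_zigzag (Quotient.exact h)
    exact ⟨⟨g.base, f⟩,
      Grothendieck.ext _ _ rfl (Subsingleton.elim (α := (_ : Discrete _) ⟶ _) _ _)⟩⟩
  essSurj := ⟨fun ⟨T, ⟨x⟩⟩ => by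
    obtain ⟨X, rfl⟩ := Quotient.exists_rep x
    exact ⟨⟨T, X⟩, ⟨Iso.refl _⟩⟩⟩

/-! ### The three homotopy sums, as groupoids over `F × T` -/

/-- The map `(w, r) : C ⥤ F × T`, sending a cut `c : S ↣ T` to `(P_c, S_c)`. -/
abbrev pruneMap : CutTree P ⥤ Forests P × Trees P :=
  (upperForest P).prod' (lowerTree P)

/-- The homotopy sum over `T` of `cut(T)`. -/
abbrev CutSum := HoSum (cut P)

/-- The structure map of the homotopy sum of `cut(T)`, sending a cut `c` to `(P_c, S_c)`: up to the
equivalence replacing the (discrete) homotopy fibres of `m` by their sets of components, it is the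
projection to `C` followed by `(w, r)`. -/
noncomputable def cutSumMap : CutSum P ⥤ Forests P × Trees P :=
  (cutComponent P).inv ⋙ CostructuredArrow.grothendieckProj (totalTree P) ⋙ pruneMap P

/-- The structure map `cutSumMap` sends (the class of) a cut `c` to `(P_c, S_c)`. -/
noncomputable def cutComponentCompCutSumMap :
    cutComponent P ⋙ cutSumMap P ≅
      CostructuredArrow.grothendieckProj (totalTree P) ⋙ pruneMap P :=
  Functor.isoWhiskerRight (cutComponent P).asEquivalence.unitIso.symm
    (CostructuredArrow.grothendieckProj (totalTree P) ⋙ pruneMap P)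

/-- The family `S ↦ F_{L(S)}` indexed by `T`. -/
abbrev forestFamily : Trees P ⥤ Cat := leafMap P ⋙ fibreFunctor (forestRootMap P)

/-- The homotopy sum over `S` in `T` of `F_{L(S)}`. -/
abbrev LeafSum := HoSum (forestFamily P)

/-- The structure map of the homotopy sum of `F_{L(S)}`, sending `(S, (Q, φ))` to `(Q, S)`. -/
def leafSumMap : LeafSum P ⥤ Forests P × Trees P :=
  CostructuredArrow.grothendieckPrecompFunctorToComma (forestRootMap P) (leafMap P) ⋙
    (Comma.fst _ _).prod' (Comma.snd _ _)

/-- The family `N ↦ F_N × _N T` indexed by `fam I`. -/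
abbrev profileFamily : Fam I ⥤ Cat :=
  prodFamily (fibreFunctor (forestRootMap P)) (fibreFunctor (leafMap P))

/-- The homotopy sum over `N` in `fam I` of `F_N × _N T`. -/
abbrev ProfileSum := HoSum (profileFamily P)

/-- The structure map of the homotopy sum of `F_N × _N T`, sending
`(N, ((Q, φ), (S, ψ)))` to `(Q, S)`. -/
def profileSumMap : ProfileSum P ⥤ Forests P × Trees P :=
  prodFibreMap (forestRootMap P) (leafMap P)

end Decorated

end FaaDiBruno

/-!
All three homotopy sums are equivalent, over `F × T`, to the homotopy pullback of the root map
`R : F ⥤ fam I` and the leaf map `L : T ⥤ fam I`: the groupoid of triples of a forest `Q`, a tree `S`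
and an isomorphism `R Q ⟶ L S`.

For the sum of `F_{L(S)}` this is the description of the Grothendieck construction of homotopy
fibres as a comma category, and for the sum of `F_N × _N T` it is `prodFibreToPullback`, which
sends `(N, (Q, φ), (S, ψ))` to `(Q, S, φ ≫ ψ⁻¹)`.

For cuts, the sum of the sets `cut(T)` is the sum of the homotopy fibres of the total tree functor
(these fibres are discrete), hence the groupoid `C` of trees with a cut. The content is that
`cutToPullback : C ⥤ F ×_{fam I} T`, sending `c` to `(P_c, S_c)` with the identification of the
roots of `P_c` with the leaves of `S_c`, is an equivalence.

* It is fully faithful because the total tree is covered by the subtree `S_c` and the ideal subtrees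
  generated by the leaves of `S_c`; these pieces share no nodes, and share edges only along the cut.
  So embeddings out of the total tree are families of embeddings out of the pieces that agree on the
  edges of the cut (`PTree.IsCover.hom_ext`, `PTree.IsCover.exists_desc`).
* It is essentially surjective because a forest can be grafted onto the leaves of a tree
  (`Grafting.tree`), and each grafted tree is recovered as the ideal subtree above its leaf
  (`Grafting.isIso_toIdeal`).

The 2-cells of embeddings are handled as arrows `c ⟶ F x` into a family `F`, bundled with the index
`x` in a sigma type, so that equations between them need no `eqToHom`.
-/

namespace FaaDiBruno

universe v v₁ v₂ v₃ u u₁ u₂ u₃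

/-! ### Homotopy pullbacks and homotopy sums of homotopy fibres -/

section HomotopySums

variable {C : Type u₁} {D : Type u₂} {B : Type u₃} [Groupoid.{v₁} C] [Groupoid.{v₂} D]
  [Groupoid.{v₃} B]

/-- For a square of `b` and `σ` with vertical arrows `ψ`, `ψ'`, passing from `φ` to `φ ≫ ψ⁻¹` turns
squares over `σ` into squares over `b`. -/
theorem comp_inv_square_iff {X X' Y Y' Z Z' : B} {a : X ⟶ X'} {b : Y ⟶ Y'} {σ : Z ⟶ Z'}
    {φ : X ⟶ Z} {φ' : X' ⟶ Z'} {ψ : Y ⟶ Z} {ψ' : Y' ⟶ Z'} (h : b ≫ ψ' = ψ ≫ σ) :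
    a ≫ φ' ≫ Groupoid.inv ψ' = (φ ≫ Groupoid.inv ψ) ≫ b ↔ a ≫ φ' = φ ≫ σ := by
  rw [← cancel_mono ψ']
  simp only [Category.assoc, h, Groupoid.inv_comp, reassoc_of% Groupoid.inv_comp ψ,
    Category.comp_id]

/-- The homotopy pullback along an identity functor is trivial. -/
instance isEquivalence_comma_fst_id (p : C ⥤ B) : (Comma.fst p (𝟭 B)).IsEquivalence where
  faithful := ⟨fun {X Y} f g h => by
    have hl : f.left = g.left := h
    have hf : p.map f.left ≫ Y.hom = X.hom ≫ f.right := f.w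
    have hg : p.map g.left ≫ Y.hom = X.hom ≫ g.right := g.w
    refine CommaMorphism.ext hl ((cancel_epi X.hom).1 ?_)
    exact hf.symm.trans ((by rw [hl] : p.map f.left ≫ Y.hom = _).trans hg)⟩
  full := ⟨fun {X Y} g => ⟨
    { left := g
      right := (Groupoid.inv X.hom ≫ p.map g ≫ Y.hom : X.right ⟶ Y.right)
      w := by
        change p.map g ≫ Y.hom = X.hom ≫ Groupoid.inv X.hom ≫ p.map g ≫ Y.hom
        simp }, rfl⟩⟩
  essSurj := ⟨fun c => ⟨{ left := c, right := p.obj c, hom := 𝟙 _ }, ⟨Iso.refl _⟩⟩⟩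

/-- The total space of the homotopy fibres of `p : C ⥤ B` is `C`. -/
instance isEquivalence_grothendieckProj (p : C ⥤ B) :
    (CostructuredArrow.grothendieckProj p).IsEquivalence :=
  have : (CostructuredArrow.grothendieckPrecompFunctorToComma p (𝟭 B)).IsEquivalence :=
    (CostructuredArrow.grothendieckPrecompFunctorEquivalence p (𝟭 B)).isEquivalence_functor
  inferInstanceAs (CostructuredArrow.grothendieckPrecompFunctorToComma p (𝟭 B) ⋙
    Comma.fst p (𝟭 B)).IsEquivalence

/-- The functor from the homotopy sum of the products of homotopy fibres of `p` and `q` to the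
homotopy pullback, sending `(b, ((x, φ), (y, ψ)))` to `(x, y, φ ≫ ψ⁻¹)`. -/
def prodFibreToPullback (p : C ⥤ B) (q : D ⥤ B) :
    HoSum (prodFamily (fibreFunctor p) (fibreFunctor q)) ⥤ HPullback p q where
  obj X :=
    { left := X.fiber.1.left
      right := X.fiber.2.left
      hom := X.fiber.1.hom ≫ Groupoid.inv X.fiber.2.hom }
  map {X Y} f :=
    { left := f.fiber.1.left
      right := f.fiber.2.left
      w := by
        have h₁ : p.map f.fiber.1.left ≫ Y.fiber.1.hom = X.fiber.1.hom ≫ f.base :=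
          CostructuredArrow.w f.fiber.1
        have h₂ : q.map f.fiber.2.left ≫ Y.fiber.2.hom = X.fiber.2.hom ≫ f.base :=
          CostructuredArrow.w f.fiber.2
        exact (comp_inv_square_iff h₂).2 h₁ }
  map_id X := CommaMorphism.ext (congrArg Prod.fst ((prodFibreMap p q).map_id X))
    (congrArg Prod.snd ((prodFibreMap p q).map_id X))
  map_comp f g := CommaMorphism.ext (congrArg Prod.fst ((prodFibreMap p q).map_comp f g))
    (congrArg Prod.snd ((prodFibreMap p q).map_comp f g))

/-- Fibrewise products summed over the base compute the homotopy pullback. -/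
instance isEquivalence_prodFibreToPullback (p : C ⥤ B) (q : D ⥤ B) :
    (prodFibreToPullback p q).IsEquivalence where
  faithful := ⟨fun {X Y} f g h => by
    have hl : f.fiber.1.left = g.fiber.1.left := congrArg CommaMorphism.left h
    have hr : f.fiber.2.left = g.fiber.2.left := congrArg CommaMorphism.right h
    have hf : q.map f.fiber.2.left ≫ Y.fiber.2.hom = X.fiber.2.hom ≫ f.base :=
      CostructuredArrow.w f.fiber.2
    have hg : q.map g.fiber.2.left ≫ Y.fiber.2.hom = X.fiber.2.hom ≫ g.base :=
      CostructuredArrow.w g.fiber.2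
    have hb : f.base = g.base := (cancel_epi X.fiber.2.hom).1
      (hf.symm.trans ((congrArg (fun k => q.map k ≫ Y.fiber.2.hom) hr).trans hg))
    obtain ⟨fb, ff⟩ := f
    obtain ⟨gb, gf⟩ := g
    obtain rfl : fb = gb := hb
    obtain rfl : ff = gf := Prod.ext (CostructuredArrow.hom_ext _ _ hl)
      (CostructuredArrow.hom_ext _ _ hr)
    rfl⟩
  full := ⟨fun {X Y} g => by
    have hw : p.map g.left ≫ Y.fiber.1.hom ≫ Groupoid.inv Y.fiber.2.hom =
      (X.fiber.1.hom ≫ Groupoid.inv X.fiber.2.hom) ≫ q.map g.right := g.w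
    let σ : X.base ⟶ Y.base := Groupoid.inv X.fiber.2.hom ≫ q.map g.right ≫ Y.fiber.2.hom
    have h₂ : q.map g.right ≫ Y.fiber.2.hom = X.fiber.2.hom ≫ σ :=
      by
      exact ((reassoc_of% Groupoid.comp_inv X.fiber.2.hom) _).symm
    have h₁ : p.map g.left ≫ Y.fiber.1.hom = X.fiber.1.hom ≫ σ := (comp_inv_square_iff h₂).1 hw
    exact ⟨⟨σ, (CostructuredArrow.homMk g.left h₁, CostructuredArrow.homMk g.right h₂)⟩, rfl⟩⟩
  essSurj := ⟨fun Z => ⟨⟨q.obj Z.right, (CostructuredArrow.mk Z.hom, CostructuredArrow.mk (𝟙 _))⟩,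
    ⟨Comma.isoMk (Iso.refl _) (Iso.refl _) (by
      change p.map (𝟙 _) ≫ Z.hom = (Z.hom ≫ Groupoid.inv (𝟙 _)) ≫ q.map (𝟙 _)
      simp)⟩⟩⟩

end HomotopySums

/-! ### Arrows into a family of objects -/

section Sigma

variable {C : Type u} [Category.{v} C]

/-- Arrows from a fixed object into members of a family, with the member as part of the data:
equality of such pairs replaces compositions with `eqToHom`. -/
theorem sigma_hom_eq_iff {X : Type*} {F : X → C} {c : C} {x y : X} {f : c ⟶ F x} {g : c ⟶ F y} :
    (⟨x, f⟩ : Σ z, (c ⟶ F z)) = ⟨y, g⟩ ↔ ∃ h : x = y, f ≫ eqToHom (congrArg F h) = g := by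
  constructor
  · intro h
    obtain ⟨rfl, h⟩ := Sigma.mk.inj_iff.1 h
    exact ⟨rfl, by simpa using eq_of_heq h⟩
  · rintro ⟨rfl, rfl⟩
    simp

theorem sigma_hom_precomp {X : Type*} {F : X → C} {c c' : C} (k : c' ⟶ c) {x y : X} {f : c ⟶ F x}
    {g : c ⟶ F y} (h : (⟨x, f⟩ : Σ z, (c ⟶ F z)) = ⟨y, g⟩) :
    (⟨x, k ≫ f⟩ : Σ z, (c' ⟶ F z)) = ⟨y, k ≫ g⟩ :=
  congrArg (fun z : Σ z, (c ⟶ F z) => (⟨z.1, k ≫ z.2⟩ : Σ z, (c' ⟶ F z))) h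

theorem sigma_hom_cancel {X : Type*} {F : X → C} {c c' : C} (k : c' ⟶ c) [IsIso k] {x y : X}
    {f : c ⟶ F x} {g : c ⟶ F y} (h : (⟨x, k ≫ f⟩ : Σ z, (c' ⟶ F z)) = ⟨y, k ≫ g⟩) :
    (⟨x, f⟩ : Σ z, (c ⟶ F z)) = ⟨y, g⟩ := by
  simpa using sigma_hom_precomp (inv k) h

/-- Arrows into a family may be composed with a map of families. -/
theorem sigma_hom_postcomp {X Y : Type*} {F : X → C} {G : Y → C} {c : C} {k : X → Y}
    (φ : ∀ x, F x ⟶ G (k x)) {x y : X} {f : c ⟶ F x} {g : c ⟶ F y}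
    (h : (⟨x, f⟩ : Σ z, (c ⟶ F z)) = ⟨y, g⟩) :
    (⟨k x, f ≫ φ x⟩ : Σ z, (c ⟶ G z)) = ⟨k y, g ≫ φ y⟩ :=
  congrArg (fun z : Σ z, (c ⟶ F z) => (⟨k z.1, z.2 ≫ φ z.1⟩ : Σ z, (c ⟶ G z))) h

theorem sigma_hom_map {D : Type*} [Category* D] (Q : C ⥤ D) {X : Type*} {F : X → C} {c : C}
    {x y : X} {f : c ⟶ F x} {g : c ⟶ F y} (h : (⟨x, f⟩ : Σ z, (c ⟶ F z)) = ⟨y, g⟩) :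
    (⟨x, Q.map f⟩ : Σ z, (Q.obj c ⟶ Q.obj (F z))) = ⟨y, Q.map g⟩ :=
  congrArg (fun z : Σ z, (c ⟶ F z) => (⟨z.1, Q.map z.2⟩ : Σ z, (Q.obj c ⟶ Q.obj (F z)))) h

/-- If `k : Y → Z` is injective, arrows into a family over `Y` are determined by their images
under a map of families lying over `k` with invertible components. -/
theorem sigma_hom_postcomp_cancel {C : Type u} [Groupoid.{v} C] {Y Z : Type*} {F : Y → C}
    {G : Z → C} {c : C} {k : Y → Z} (hk : Function.Injective k) (φ : ∀ x, F x ⟶ G (k x)) {x y : Y}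
    {f : c ⟶ F x} {g : c ⟶ F y}
    (h : (⟨k x, f ≫ φ x⟩ : Σ z, (c ⟶ G z)) = ⟨k y, g ≫ φ y⟩) :
    (⟨x, f⟩ : Σ z, (c ⟶ F z)) = ⟨y, g⟩ := by
  obtain ⟨h₁, h₂⟩ := sigma_hom_eq_iff.1 h
  obtain rfl := hk h₁
  obtain rfl : f = g := (cancel_mono (φ x)).1 ((Category.comp_id _).symm.trans h₂)
  rfl

/-- Arrows between families agree if their components do, as arrows into the target family. -/
theorem Fam.hom_ext_sigma {C : Type u} [Groupoid.{v} C] {X Y : Fam C} {f g : X ⟶ Y}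
    (h : ∀ i, (⟨f.e i, f.φ i⟩ : Σ j, (X.obj i ⟶ Y.obj j)) = ⟨g.e i, g.φ i⟩) : f = g :=
  Fam.Hom.ext' (Equiv.ext fun i => congrArg Sigma.fst (h i))
    fun i => (sigma_hom_eq_iff.1 (h i)).2

end Sigma

/-! ### Gluing embeddings of decorated trees along covers -/

namespace Tree

theorem Emb.n_injective {S T : Tree} (f : Emb S T) (hf : Function.Injective f.a) :
    Function.Injective f.n := fun k k' h =>
  S.t_inj (hf (by rw [f.t_comm, f.t_comm, h]))

theorem Emb.m_injective {S T : Tree} (f : Emb S T) (hf : Function.Injective f.a) :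
    Function.Injective f.m := fun k k' h =>
  S.s_inj (hf (by rw [f.s_comm, f.s_comm, h]))

end Tree

section Glue

variable {I : Type u₁} {E : Type u₂} {B : Type u₃}
  [Groupoid.{v₁} I] [Groupoid.{v₂} E] [Groupoid.{v₃} B] {P : PolyEndo I E B}

namespace PTree

/-- The left square of an embedding as an equation between arrows into the family of edge colours;
similarly for `Hom.sigma_p` and `Hom.sigma_t`. -/
theorem Hom.sigma_s {S T : PTree P} (f : S ⟶ T) (x : S.M) :
    (⟨f.a (S.s x), S.sIso x ≫ f.ha (S.s x)⟩ : Σ y, (P.s.obj (S.β x) ⟶ T.α y)) =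
      ⟨T.s (f.m x), P.s.map (f.hm x) ≫ T.sIso (f.m x)⟩ :=
  sigma_hom_eq_iff.2 ⟨f.s_comm x, by rw [Category.assoc]; exact f.sq_s x⟩

theorem Hom.sigma_p {S T : PTree P} (f : S ⟶ T) (x : S.M) :
    (⟨f.n (S.p x), S.pIso x ≫ f.hn (S.p x)⟩ : Σ y, (P.p.obj (S.β x) ⟶ T.γ y)) =
      ⟨T.p (f.m x), P.p.map (f.hm x) ≫ T.pIso (f.m x)⟩ :=
  sigma_hom_eq_iff.2 ⟨f.p_comm x, by rw [Category.assoc]; exact f.sq_p x⟩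

theorem Hom.sigma_t {S T : PTree P} (f : S ⟶ T) (x : S.N) :
    (⟨f.a (S.t x), S.tIso x ≫ f.ha (S.t x)⟩ : Σ y, (P.t.obj (S.γ x) ⟶ T.α y)) =
      ⟨T.t (f.n x), P.t.map (f.hn x) ≫ T.tIso (f.n x)⟩ :=
  sigma_hom_eq_iff.2 ⟨f.t_comm x, by rw [Category.assoc]; exact f.sq_t x⟩

/-- Embeddings of `P`-trees from equations between arrows into the families of decorations. -/
def homOfSigma {S T : PTree P} (a : S.A → T.A) (m : S.M → T.M) (n : S.N → T.N)
    (ha : ∀ x, S.α x ⟶ T.α (a x)) (hm : ∀ x, S.β x ⟶ T.β (m x)) (hn : ∀ x, S.γ x ⟶ T.γ (n x))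
    (hs : ∀ x, (⟨a (S.s x), S.sIso x ≫ ha (S.s x)⟩ : Σ y, (P.s.obj (S.β x) ⟶ T.α y)) =
      ⟨T.s (m x), P.s.map (hm x) ≫ T.sIso (m x)⟩)
    (hp : ∀ x, (⟨n (S.p x), S.pIso x ≫ hn (S.p x)⟩ : Σ y, (P.p.obj (S.β x) ⟶ T.γ y)) =
      ⟨T.p (m x), P.p.map (hm x) ≫ T.pIso (m x)⟩)
    (ht : ∀ x, (⟨a (S.t x), S.tIso x ≫ ha (S.t x)⟩ : Σ y, (P.t.obj (S.γ x) ⟶ T.α y)) =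
      ⟨T.t (n x), P.t.map (hn x) ≫ T.tIso (n x)⟩)
    (cart : ∀ (k : S.N) (y : T.M), T.p y = n k → ∃! x : S.M, S.p x = k ∧ m x = y) :
    S ⟶ T :=
  { a := a
    m := m
    n := n
    s_comm := fun x => (sigma_hom_eq_iff.1 (hs x)).1
    p_comm := fun x => (sigma_hom_eq_iff.1 (hp x)).1
    t_comm := fun x => (sigma_hom_eq_iff.1 (ht x)).1
    cart := cart
    ha := ha
    hm := hm
    hn := hn
    sq_s := fun x =>
      (Category.assoc _ _ _).symm.trans (sigma_hom_eq_iff.1 (hs x)).2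
    sq_p := fun x =>
      (Category.assoc _ _ _).symm.trans (sigma_hom_eq_iff.1 (hp x)).2
    sq_t := fun x =>
      (Category.assoc _ _ _).symm.trans (sigma_hom_eq_iff.1 (ht x)).2 : Hom S T }

theorem hom_ext_sigma {S T : PTree P} {f g : S ⟶ T}
    (ha : ∀ x, (⟨f.a x, f.ha x⟩ : Σ y, (S.α x ⟶ T.α y)) = ⟨g.a x, g.ha x⟩)
    (hm : ∀ x, (⟨f.m x, f.hm x⟩ : Σ y, (S.β x ⟶ T.β y)) = ⟨g.m x, g.hm x⟩)
    (hn : ∀ x, (⟨f.n x, f.hn x⟩ : Σ y, (S.γ x ⟶ T.γ y)) = ⟨g.n x, g.hn x⟩) : f = g :=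
  Hom.ext' (Tree.Emb.ext (funext fun x => congrArg Sigma.fst (ha x))
      (funext fun x => congrArg Sigma.fst (hm x)) (funext fun x => congrArg Sigma.fst (hn x)))
    (fun x => (sigma_hom_eq_iff.1 (ha x)).2) (fun x => (sigma_hom_eq_iff.1 (hm x)).2)
    (fun x => (sigma_hom_eq_iff.1 (hn x)).2)

theorem sigma_a_congr {S T : PTree P} {f g : S ⟶ T} (h : f = g) (x : S.A) :
    (⟨f.a x, f.ha x⟩ : Σ y, (S.α x ⟶ T.α y)) = ⟨g.a x, g.ha x⟩ := by
  rw [h]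

theorem sigma_m_congr {S T : PTree P} {f g : S ⟶ T} (h : f = g) (x : S.M) :
    (⟨f.m x, f.hm x⟩ : Σ y, (S.β x ⟶ T.β y)) = ⟨g.m x, g.hm x⟩ := by
  rw [h]

theorem sigma_n_congr {S T : PTree P} {f g : S ⟶ T} (h : f = g) (x : S.N) :
    (⟨f.n x, f.hn x⟩ : Σ y, (S.γ x ⟶ T.γ y)) = ⟨g.n x, g.hn x⟩ := by
  rw [h]

/-- Embeddings of `P`-trees that are injective on edges are monomorphisms. -/
theorem cancel_of_injective {S T U : PTree P} {c : T ⟶ U} (hc : Function.Injective c.a)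
    {f g : S ⟶ T} (h : f ≫ c = g ≫ c) : f = g :=
  hom_ext_sigma
    (fun x => sigma_hom_postcomp_cancel hc c.ha (sigma_a_congr h x))
    (fun x => sigma_hom_postcomp_cancel (c.toEmb.m_injective hc) c.hm (sigma_m_congr h x))
    (fun x => sigma_hom_postcomp_cancel (c.toEmb.n_injective hc) c.hn (sigma_n_congr h x))

/-- A cover of a `P`-tree `T` by pieces: embeddings `i j : D j ⟶ T` that are jointly surjective on
edges and jointly bijective on nodes, so that distinct pieces overlap only in edges. -/
structure IsCover {J : Type*} {D : J → PTree P} {T : PTree P} (i : ∀ j, D j ⟶ T) : Prop where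
  exists_a : ∀ x, ∃ j y, (i j).a y = x
  exists_n : ∀ x, ∃ j y, (i j).n y = x
  unique_n : ∀ {j j' y y'}, (i j).n y = (i j').n y' → (⟨j, y⟩ : Σ j, (D j).N) = ⟨j', y'⟩

namespace IsCover

variable {J : Type*} {D : J → PTree P} {T U : PTree P} {i : ∀ j, D j ⟶ T}

theorem exists_m (h : IsCover i) (x : T.M) : ∃ j y, (i j).m y = x := by
  obtain ⟨j, y, hy⟩ := h.exists_n (T.p x)
  obtain ⟨z, ⟨-, hz⟩, -⟩ := (i j).cart y x hy.symm
  exact ⟨j, z, hz⟩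

theorem unique_m (h : IsCover i) {j j' y y'} (hy : (i j).m y = (i j').m y') :
    (⟨j, y⟩ : Σ j, (D j).M) = ⟨j', y'⟩ := by
  have hp : (⟨j, (D j).p y⟩ : Σ j, (D j).N) = ⟨j', (D j').p y'⟩ :=
    h.unique_n (by rw [(i j).p_comm, (i j').p_comm, hy])
  obtain ⟨rfl, hp⟩ := Sigma.mk.inj_iff.1 hp
  rw [((i j).cart _ _ ((i j).p_comm y').symm).unique ⟨eq_of_heq hp, hy⟩ ⟨rfl, rfl⟩]

/-- The pieces of a cover are jointly epimorphic. -/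
theorem hom_ext (h : IsCover i) {f g : T ⟶ U} (hfg : ∀ j, i j ≫ f = i j ≫ g) : f = g := by
  refine hom_ext_sigma (fun x => ?_) (fun x => ?_) (fun x => ?_)
  · obtain ⟨j, y, rfl⟩ := h.exists_a x
    exact sigma_hom_cancel _ (sigma_a_congr (hfg j) y)
  · obtain ⟨j, y, rfl⟩ := h.exists_m x
    exact sigma_hom_cancel _ (sigma_m_congr (hfg j) y)
  · obtain ⟨j, y, rfl⟩ := h.exists_n x
    exact sigma_hom_cancel _ (sigma_n_congr (hfg j) y)

/-- Embeddings of the pieces of a cover that agree on the common edges glue. -/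
theorem exists_desc (h : IsCover i) (g : ∀ j, D j ⟶ U)
    (hg : ∀ {j j'} (y y') (e : (i j).a y = (i j').a y'),
      (⟨(g j).a y, Groupoid.inv ((i j).ha y) ≫ (g j).ha y⟩ :
        Σ z, (T.α ((i j).a y) ⟶ U.α z)) =
      ⟨(g j').a y', eqToHom (congrArg T.α e) ≫ Groupoid.inv ((i j').ha y') ≫ (g j').ha y'⟩) :
    ∃ f : T ⟶ U, ∀ j, i j ≫ f = g j := by
  -- on each edge, marked node and node of `T`, use any piece containing it
  have key_a : ∀ x : T.A, ∃ z : Σ z, (T.α x ⟶ U.α z), ∀ j y (e : (i j).a y = x),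
      (⟨z.1, (i j).ha y ≫ eqToHom (congrArg T.α e) ≫ z.2⟩ : Σ z, ((D j).α y ⟶ U.α z)) =
        ⟨(g j).a y, (g j).ha y⟩ := by
    intro x
    obtain ⟨j, y, rfl⟩ := h.exists_a x
    refine ⟨⟨(g j).a y, Groupoid.inv ((i j).ha y) ≫ (g j).ha y⟩, fun j' y' e => ?_⟩
    have := sigma_hom_precomp ((i j').ha y') (hg y' y e)
    simpa using this.symm
  have key_m : ∀ x : T.M, ∃ z : Σ z, (T.β x ⟶ U.β z), ∀ j y (e : (i j).m y = x),
      (⟨z.1, (i j).hm y ≫ eqToHom (congrArg T.β e) ≫ z.2⟩ : Σ z, ((D j).β y ⟶ U.β z)) =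
        ⟨(g j).m y, (g j).hm y⟩ := by
    intro x
    obtain ⟨j, y, rfl⟩ := h.exists_m x
    refine ⟨⟨(g j).m y, Groupoid.inv ((i j).hm y) ≫ (g j).hm y⟩, fun j' y' e => ?_⟩
    obtain ⟨rfl, e'⟩ := Sigma.mk.inj_iff.1 (h.unique_m e)
    obtain rfl := eq_of_heq e'
    simp
  have key_n : ∀ x : T.N, ∃ z : Σ z, (T.γ x ⟶ U.γ z), ∀ j y (e : (i j).n y = x),
      (⟨z.1, (i j).hn y ≫ eqToHom (congrArg T.γ e) ≫ z.2⟩ : Σ z, ((D j).γ y ⟶ U.γ z)) =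
        ⟨(g j).n y, (g j).hn y⟩ := by
    intro x
    obtain ⟨j, y, rfl⟩ := h.exists_n x
    refine ⟨⟨(g j).n y, Groupoid.inv ((i j).hn y) ≫ (g j).hn y⟩, fun j' y' e => ?_⟩
    obtain ⟨rfl, e'⟩ := Sigma.mk.inj_iff.1 (h.unique_n e)
    obtain rfl := eq_of_heq e'
    simp
  choose a ha using key_a
  choose m hm using key_m
  choose n hn using key_n
  replace ha : ∀ j y, (⟨(a ((i j).a y)).1, (i j).ha y ≫ (a ((i j).a y)).2⟩ :
      Σ z, ((D j).α y ⟶ U.α z)) = ⟨(g j).a y, (g j).ha y⟩ := fun j y => by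
    simpa using ha _ j y rfl
  replace hm : ∀ j y, (⟨(m ((i j).m y)).1, (i j).hm y ≫ (m ((i j).m y)).2⟩ :
      Σ z, ((D j).β y ⟶ U.β z)) = ⟨(g j).m y, (g j).hm y⟩ := fun j y => by
    simpa using hm _ j y rfl
  replace hn : ∀ j y, (⟨(n ((i j).n y)).1, (i j).hn y ≫ (n ((i j).n y)).2⟩ :
      Σ z, ((D j).γ y ⟶ U.γ z)) = ⟨(g j).n y, (g j).hn y⟩ := fun j y => by
    simpa using hn _ j y rfl
  -- each square is checked after restriction to a piece, where it is a square of `g j`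
  refine ⟨homOfSigma (fun x => (a x).1) (fun x => (m x).1) (fun x => (n x).1)
    (fun x => (a x).2) (fun x => (m x).2) (fun x => (n x).2) ?_ ?_ ?_ ?_,
    fun j => hom_ext_sigma (ha j) (hm j) (hn j)⟩
  · intro x
    obtain ⟨j, y, rfl⟩ := h.exists_m x
    refine sigma_hom_cancel (P.s.map ((i j).hm y)) ?_
    have h₁ := sigma_hom_postcomp (fun x => (a x).2) ((i j).sigma_s y)
    have h₂ := sigma_hom_precomp ((D j).sIso y) (ha j ((D j).s y))
    have h₃ := sigma_hom_postcomp U.sIso (sigma_hom_map P.s (hm j y))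
    have h₄ := ((h₁.symm.trans (by simpa using h₂)).trans ((g j).sigma_s y)).trans h₃.symm
    simpa using h₄
  · intro x
    obtain ⟨j, y, rfl⟩ := h.exists_m x
    refine sigma_hom_cancel (P.p.map ((i j).hm y)) ?_
    have h₁ := sigma_hom_postcomp (fun x => (n x).2) ((i j).sigma_p y)
    have h₂ := sigma_hom_precomp ((D j).pIso y) (hn j ((D j).p y))
    have h₃ := sigma_hom_postcomp U.pIso (sigma_hom_map P.p (hm j y))
    have h₄ := ((h₁.symm.trans (by simpa using h₂)).trans ((g j).sigma_p y)).trans h₃.symm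
    simpa using h₄
  · intro x
    obtain ⟨j, y, rfl⟩ := h.exists_n x
    refine sigma_hom_cancel (P.t.map ((i j).hn y)) ?_
    have h₁ := sigma_hom_postcomp (fun x => (a x).2) ((i j).sigma_t y)
    have h₂ := sigma_hom_precomp ((D j).tIso y) (ha j ((D j).t y))
    have h₃ := sigma_hom_postcomp U.tIso (sigma_hom_map P.t (hn j y))
    have h₄ := ((h₁.symm.trans (by simpa using h₂)).trans ((g j).sigma_t y)).trans h₃.symm
    simpa using h₄
  · intro k y hk
    obtain ⟨j, k, rfl⟩ := h.exists_n k
    have hn' : (n ((i j).n k)).1 = (g j).n k := congrArg Sigma.fst (hn j k)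
    have hm' : ∀ z, (m ((i j).m z)).1 = (g j).m z := fun z => congrArg Sigma.fst (hm j z)
    obtain ⟨x, ⟨hx₁, hx₂⟩, hx⟩ := (g j).cart k y (hk.trans hn')
    refine ⟨(i j).m x, ⟨?_, (hm' x).trans hx₂⟩, ?_⟩
    · rw [← (i j).p_comm, hx₁]
    · rintro z ⟨hz, rfl⟩
      obtain ⟨w, ⟨hw, rfl⟩, -⟩ := (i j).cart k z hz
      rw [hx w ⟨hw, (hm' w).symm⟩]

end IsCover

/-- A root-preserving embedding that is surjective on edges and nodes is invertible. -/
theorem isIso_of_surjective {S T : PTree P} (f : S ⟶ T) (hr : f.a S.root = T.root)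
    (ha : Function.Surjective f.a) (hn : Function.Surjective f.n) : IsIso f := by
  have hi := f.toEmb.a_injective hr
  have hc : IsCover (fun _ : Unit => f) :=
    { exists_a := fun x => ⟨(), ha x⟩
      exists_n := fun x => ⟨(), hn x⟩
      unique_n := fun h => by rw [f.toEmb.n_injective hi h] }
  obtain ⟨g, hg⟩ := hc.exists_desc (fun _ => 𝟙 S) (by
    rintro _ _ y y' e
    obtain rfl := hi e
    simp)
  exact ⟨g, hg (), hc.hom_ext fun _ => by rw [reassoc_of% hg ()]; simp⟩

end PTree

end Glue

/-! ### Edges above the leaves of a root-preserving subtree -/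

namespace Tree

theorem Above.trans {T : Tree} {x y z : T.A} (h : T.Above x y) (h' : T.Above y z) :
    T.Above x z := by
  induction h' with
  | refl => exact h
  | step m _ ih => exact .step m ih

theorem above_root (T : Tree) (x : T.A) : T.Above T.root x := by
  induction x using root_induction with
  | h₀ => exact .refl
  | h₁ m ih => exact .step m ih

theorem Above.eq_root {T : Tree} {x y : T.A} (h : T.Above x y) (hy : y = T.root) : x = T.root := by
  cases h with
  | refl => exact hy
  | step m _ => exact absurd hy (s_ne_root m)

theorem above_s_iff {T : Tree} {x : T.A} {m : T.M} :
    T.Above x (T.s m) ↔ x = T.s m ∨ T.Above x (T.t (T.p m)) := by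
  refine ⟨fun h => ?_, ?_⟩
  · generalize hy : T.s m = y at h
    cases h with
    | refl => exact Or.inl rfl
    | step m' h =>
      obtain rfl := T.s_inj hy
      exact Or.inr h
  · rintro (rfl | h)
    · exact .refl
    · exact .step m h

theorem Above.total {T : Tree} {x y z : T.A} (hx : T.Above x z) (hy : T.Above y z) :
    T.Above x y ∨ T.Above y x := by
  induction hx with
  | refl => exact Or.inr hy
  | step m h ih =>
    rcases above_s_iff.1 hy with rfl | hy
    · exact Or.inl (.step m h)
    · exact ih hy

/-- In a root-preserving subtree, nothing but a leaf itself lies above that leaf. -/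
theorem Emb.eq_of_above_leaf {S T : Tree} (f : Emb S T) (hf : f.a S.root = T.root) (x : S.Leaf)
    {y : S.A} (h : T.Above (f.a x.1) (f.a y)) : x.1 = y := by
  induction y using root_induction with
  | h₀ => exact f.a_injective hf ((h.eq_root hf).trans hf.symm)
  | h₁ m ih =>
    rw [f.s_comm, above_s_iff, ← f.s_comm, ← f.p_comm, ← f.t_comm] at h
    rcases h with h | h
    · exact f.a_injective hf h
    · exact absurd (ih h).symm (x.2 _)

/-- The ideals generated by distinct leaves of a root-preserving subtree are disjoint. -/
theorem Emb.leaf_eq_of_above {S T : Tree} (f : Emb S T) (hf : f.a S.root = T.root) {x y : S.Leaf}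
    {z : T.A} (hx : T.Above (f.a x.1) z) (hy : T.Above (f.a y.1) z) : x = y := by
  rcases hx.total hy with h | h
  · exact Subtype.ext (f.eq_of_above_leaf hf x h)
  · exact (Subtype.ext (f.eq_of_above_leaf hf y h)).symm

/-- A root-preserving subtree and the ideals generated by its leaves cover the edges. -/
theorem Emb.exists_a_or_above {S T : Tree} (f : Emb S T) (hf : f.a S.root = T.root) (z : T.A) :
    (∃ y, f.a y = z) ∨ ∃ x : S.Leaf, T.Above (f.a x.1) z := by
  induction z using root_induction with
  | h₀ => exact Or.inl ⟨_, hf⟩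
  | h₁ m ih =>
    rcases ih with ⟨y, hy⟩ | ⟨x, hx⟩
    · by_cases h : ∃ k, S.t k = y
      · obtain ⟨k, rfl⟩ := h
        rw [f.t_comm] at hy
        obtain ⟨m', ⟨-, rfl⟩, -⟩ := f.cart k m (T.t_inj hy).symm
        exact Or.inl ⟨S.s m', f.s_comm m'⟩
      · refine Or.inr ⟨⟨y, fun k hk => h ⟨k, hk⟩⟩, .step m ?_⟩
        rw [← hy]
        exact .refl
    · exact Or.inr ⟨x, .step m hx⟩

/-- A root-preserving subtree and the ideals generated by its leaves cover the nodes. -/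
theorem Emb.exists_n_or_above {S T : Tree} (f : Emb S T) (hf : f.a S.root = T.root) (z : T.N) :
    (∃ y, f.n y = z) ∨ ∃ x : S.Leaf, T.Above (f.a x.1) (T.t z) := by
  rcases f.exists_a_or_above hf (T.t z) with ⟨y, hy⟩ | h
  · by_cases h : ∃ k, S.t k = y
    · obtain ⟨k, rfl⟩ := h
      exact Or.inl ⟨k, T.t_inj ((f.t_comm k).symm.trans hy)⟩
    · refine Or.inr ⟨⟨y, fun k hk => h ⟨k, hk⟩⟩, ?_⟩
      rw [← hy]
      exact .refl
  · exact Or.inr h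

end Tree

section Cut

variable {I : Type u₁} {E : Type u₂} {B : Type u₃}
  [Groupoid.{v₁} I] [Groupoid.{v₂} E] [Groupoid.{v₃} B] {P : PolyEndo I E B}

namespace PTree

/-- The inclusion of an ideal subtree. -/
def idealIncl (T : PTree P) (e : T.A) : T.ideal e ⟶ T :=
  { a := Subtype.val
    m := Subtype.val
    n := Subtype.val
    s_comm := fun _ => rfl
    p_comm := fun _ => rfl
    t_comm := fun _ => rfl
    cart := fun k y h => ⟨⟨y, by rw [h]; exact k.2⟩, ⟨Subtype.ext h, rfl⟩,
      fun _ hz => Subtype.ext hz.2⟩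
    ha := fun x => 𝟙 (T.α x.1)
    hm := fun x => 𝟙 (T.β x.1)
    hn := fun x => 𝟙 (T.γ x.1)
    sq_s := fun x => by
      change T.sIso x.1 ≫ 𝟙 _ ≫ 𝟙 _ = P.s.map (𝟙 _) ≫ T.sIso x.1
      simp
    sq_p := fun x => by
      change T.pIso x.1 ≫ 𝟙 _ ≫ 𝟙 _ = P.p.map (𝟙 _) ≫ T.pIso x.1
      simp
    sq_t := fun x => by
      change T.tIso x.1 ≫ 𝟙 _ ≫ 𝟙 _ = P.t.map (𝟙 _) ≫ T.tIso x.1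
      simp : Hom (T.ideal e) T }

theorem idealIncl_injective (T : PTree P) (e : T.A) :
    Function.Injective (T.idealIncl e).a := Subtype.val_injective

theorem ideal_comp_incl {S T : PTree P} (f : S ⟶ T) {e : S.A} {e' : T.A} (h : f.a e = e') :
    Hom.ideal f h ≫ T.idealIncl e' = S.idealIncl e ≫ f :=
  hom_ext_sigma
    (fun x => Sigma.ext rfl (heq_of_eq ((Category.comp_id (f.ha x.1)).trans
      (Category.id_comp (f.ha x.1)).symm)))
    (fun x => Sigma.ext rfl (heq_of_eq ((Category.comp_id (f.hm x.1)).trans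
      (Category.id_comp (f.hm x.1)).symm)))
    (fun x => Sigma.ext rfl (heq_of_eq ((Category.comp_id (f.hn x.1)).trans
      (Category.id_comp (f.hn x.1)).symm)))

/-- An embedding factors through the ideal subtree generated by the image of the root. -/
def toIdeal {S T : PTree P} (f : S ⟶ T) {e : T.A} (h : f.a S.root = e) : S ⟶ T.ideal e :=
  { a := fun x => ⟨f.a x, h ▸ (S.above_root x).map f.toEmb⟩
    m := fun x => ⟨f.m x, by
      have := (S.above_root (S.t (S.p x))).map f.toEmb
      rwa [h, f.t_comm, f.p_comm] at this⟩
    n := fun x => ⟨f.n x, by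
      have := (S.above_root (S.t x)).map f.toEmb
      rwa [h, f.t_comm] at this⟩
    s_comm := fun x => Subtype.ext (f.s_comm x)
    p_comm := fun x => Subtype.ext (f.p_comm x)
    t_comm := fun x => Subtype.ext (f.t_comm x)
    cart := fun k y hy => by
      obtain ⟨x, ⟨hx, hxy⟩, hx'⟩ := f.cart k y.1 (congrArg Subtype.val hy)
      exact ⟨x, ⟨hx, Subtype.ext hxy⟩, fun z hz => hx' z ⟨hz.1, congrArg Subtype.val hz.2⟩⟩
    ha := f.ha
    hm := f.hm
    hn := f.hn
    sq_s := f.sq_s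
    sq_p := f.sq_p
    sq_t := f.sq_t : Hom S (T.ideal e) }

/-- Isomorphisms onto ideal subtrees of `T` with equal generating index agree if their composites
with the inclusions into `T` do. -/
theorem sigma_ideal_ext {T : PTree P} {S : Trees P} {K : Type*} {e : K → T.A} {x y : K}
    {f : S ⟶ ⟨T.ideal (e x)⟩} {g : S ⟶ ⟨T.ideal (e y)⟩} (h : x = y)
    (h' : f.iso.hom ≫ T.idealIncl (e x) = g.iso.hom ≫ T.idealIncl (e y)) :
    (⟨x, f⟩ : Σ z, (S ⟶ (⟨T.ideal (e z)⟩ : Trees P))) = ⟨y, g⟩ := by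
  subst h
  have : f = g := CoreHom.ext (Iso.ext (cancel_of_injective (T.idealIncl_injective _) h'))
  rw [this]

end PTree

namespace CutTree

/-- The pieces of a tree with a cut: the subtree below the cut and the ideal subtrees generated by
its leaves. -/
def piece (X : CutTree P) : Option X.S.Leaf → PTree P
  | none => X.S
  | some x => X.T.ideal (X.c.a x.1)

/-- The inclusions of the pieces of a tree with a cut. -/
def pieceIncl (X : CutTree P) : ∀ j, X.piece j ⟶ X.T
  | none => X.c
  | some x => X.T.idealIncl (X.c.a x.1)

/-- The total tree is covered by the subtree below the cut and the ideal subtrees above it. -/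
theorem isCover (X : CutTree P) : PTree.IsCover X.pieceIncl where
  exists_a z := by
    rcases X.c.exists_a_or_above X.root_pres z with ⟨y, hy⟩ | ⟨x, hx⟩
    · exact ⟨none, y, hy⟩
    · exact ⟨some x, ⟨z, hx⟩, rfl⟩
  exists_n z := by
    rcases X.c.exists_n_or_above X.root_pres z with ⟨y, hy⟩ | ⟨x, hx⟩
    · exact ⟨none, y, hy⟩
    · exact ⟨some x, ⟨z, hx⟩, rfl⟩
  unique_n {j j' y y'} h := by
    -- a leaf of the subtree stays a leaf relative to the nodes of the subtree
    have key : ∀ (x : X.S.Leaf) (k : X.S.N), ¬ X.T.Above (X.c.a x.1) (X.T.t (X.c.n k)) := by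
      intro x k hk
      rw [← X.c.t_comm] at hk
      exact x.2 k (X.c.eq_of_above_leaf X.root_pres x hk).symm
    match j, j', y, y', h with
    | none, none, y, y', h =>
      have : y = y' := X.c.n_injective (X.c.a_injective X.root_pres) h
      rw [this]
    | none, some x, y, y', h =>
      exact absurd (by rw [show X.c.n y = y'.1 from h]; exact y'.2) (key x y)
    | some x, none, y, y', h =>
      exact absurd (by rw [← show y.1 = X.c.n y' from h]; exact y.2) (key x y')
    | some x, some x', ⟨y, hy⟩, ⟨y', hy'⟩, h =>
      obtain rfl : y = y' := h
      obtain rfl := X.c.leaf_eq_of_above X.root_pres hy hy'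
      rfl

theorem hom_ext (X : CutTree P) {U : PTree P} {f g : X.T ⟶ U} (h : X.c ≫ f = X.c ≫ g)
    (h' : ∀ x : X.S.Leaf, X.T.idealIncl (X.c.a x.1) ≫ f = X.T.idealIncl (X.c.a x.1) ≫ g) :
    f = g :=
  X.isCover.hom_ext fun
    | none => h
    | some x => h' x

/-- Embeddings out of the subtree below the cut and out of the ideal subtrees above it glue as soon
as they agree on the edges of the cut. -/
theorem exists_desc (X : CutTree P) {U : PTree P} (f : X.S ⟶ U)
    (g : ∀ x : X.S.Leaf, X.T.ideal (X.c.a x.1) ⟶ U)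
    (hfg : ∀ x : X.S.Leaf, (⟨f.a x.1, f.ha x.1⟩ : Σ z, (X.S.α x.1 ⟶ U.α z)) =
      ⟨(g x).a (X.T.ideal (X.c.a x.1)).root,
        X.c.ha x.1 ≫ (g x).ha (X.T.ideal (X.c.a x.1)).root⟩) :
    ∃ τ : X.T ⟶ U, X.c ≫ τ = f ∧ ∀ x, X.T.idealIncl (X.c.a x.1) ≫ τ = g x := by
  let G : ∀ j, X.piece j ⟶ U
    | none => f
    | some x => g x
  have inj := X.c.a_injective X.root_pres
  have key₁ : ∀ {a b c : I} (f : a ⟶ b) (g : b ⟶ c), Groupoid.inv f ≫ f ≫ g = g :=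
    fun f g => (reassoc_of% Groupoid.inv_comp f) g
  have key₂ : ∀ {a b : I} (f : a ⟶ b), 𝟙 a ≫ Groupoid.inv (𝟙 a) ≫ f = f := fun f => by simp
  have key₃ : ∀ {a b : I} (f : a ⟶ b), Groupoid.inv (𝟙 a) ≫ f = f := fun f => by simp
  obtain ⟨τ, hτ⟩ := X.isCover.exists_desc G (by
    intro j j' y y' e
    match j, j', y, y', e with
    | none, none, y, y', e =>
      obtain rfl := inj e
      refine Sigma.ext rfl (heq_of_eq ?_)
      exact (Category.id_comp _).symm
    | none, some x, y, ⟨y', hy'⟩, e =>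
      obtain rfl : X.c.a y = y' := e
      obtain rfl := X.c.eq_of_above_leaf X.root_pres x hy'
      refine (sigma_hom_precomp (Groupoid.inv (X.c.ha x.1)) (hfg x)).trans
        (Sigma.ext rfl (heq_of_eq ?_))
      exact (key₁ _ _).trans (key₂ _).symm
    | some x, none, ⟨y, hy⟩, y', e =>
      obtain rfl : y = X.c.a y' := e
      obtain rfl := X.c.eq_of_above_leaf X.root_pres x hy
      refine Eq.trans ?_ ((sigma_hom_precomp (Groupoid.inv (X.c.ha x.1)) (hfg x).symm).trans ?_)
      · exact Sigma.ext rfl (heq_of_eq ((key₃ _).trans (key₁ _ _).symm))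
      · exact Sigma.ext rfl (heq_of_eq (Category.id_comp _).symm)
    | some x, some x', ⟨y, hy⟩, ⟨y', hy'⟩, e =>
      obtain rfl : y = y' := e
      obtain rfl := X.c.leaf_eq_of_above X.root_pres hy hy'
      refine Sigma.ext rfl (heq_of_eq ?_)
      exact (Category.id_comp _).symm)
  exact ⟨τ, hτ none, fun x => hτ (some x)⟩

end CutTree

/-! ### A cut is a tree together with a forest on its leaves -/

variable (P)

/-- The functor sending a cut `c : S ↣ T` to the forest `P_c`, the tree `S_c` and the identification
of the roots of the former with the leaves of the latter, which on colours is the inverse of the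
2-cell of `c`. -/
def cutToPullback : CutTree P ⥤ HPullback (forestRootMap P) (leafMap P) where
  obj X :=
    { left := (upperForest P).obj X
      right := (lowerTree P).obj X
      hom := ⟨Equiv.refl _, fun x => Groupoid.inv (X.c.ha x.1)⟩ }
  map {X Y} f :=
    { left := (upperForest P).map f
      right := (lowerTree P).map f
      w := by
        have key : ∀ {a b c d e : I} (f : a ⟶ b) (g : b ⟶ c) (k : c ⟶ d) (f' : a ⟶ e) (g' : e ⟶ d),
            (f ≫ g) ≫ k = f' ≫ g' → (g ≫ k) ≫ Groupoid.inv g' = Groupoid.inv f ≫ f' := by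
          intro a b c d e f g k f' g' h
          rw [← cancel_epi f, ← cancel_mono g']
          simpa using h
        refine Fam.hom_ext_sigma fun x => Sigma.ext rfl (heq_of_eq ?_)
        exact key _ _ _ _ _ (sigma_hom_eq_iff.1 (PTree.sigma_a_congr f.comm x.1)).2 }
  map_id X := CommaMorphism.ext ((upperForest P).map_id X) ((lowerTree P).map_id X)
  map_comp f g := CommaMorphism.ext ((upperForest P).map_comp f g) ((lowerTree P).map_comp f g)

/-- An isomorphism of trees with a cut is determined on the pieces. -/
instance : (cutToPullback P).Faithful where
  map_injective {X Y f g} h := by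
    have hl : (upperForest P).map f = (upperForest P).map g := congrArg CommaMorphism.left h
    have hr : f.σ = g.σ := congrArg CoreHom.iso (congrArg CommaMorphism.right h)
    refine CutTree.hom_ext_of_total (Iso.ext (X.hom_ext ?_ fun x => ?_))
    · rw [f.comm, g.comm, hr]
    · rw [← PTree.ideal_comp_incl f.τ.hom (PTree.congr_a f.comm x.1),
        ← PTree.ideal_comp_incl g.τ.hom (PTree.congr_a g.comm x.1)]
      exact congrArg (fun k : (upperForest P).obj X ⟶ (upperForest P).obj Y =>
        (k.φ x).iso.hom ≫ Y.T.idealIncl (Y.c.a (k.e x).1)) hl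

/-- Isomorphisms of the pieces that agree along the cut glue to an isomorphism of the total trees. -/
instance : (cutToPullback P).Full where
  map_surjective {X Y} F := by
    let σ : X.S ≅ Y.S := F.right.iso
    let G : (upperForest P).obj X ⟶ (upperForest P).obj Y := F.left
    -- `F` respects the bijections between roots and leaves
    have hw : ∀ x : X.S.Leaf, G.e x = PTree.leafEquiv σ x := fun x =>
      congrArg (fun k : Fam.Hom _ _ => k.e x) F.w
    have hroot : ∀ x : X.S.Leaf, (G.φ x).iso.hom.a (X.T.ideal (X.c.a x.1)).root =
      (Y.T.ideal (Y.c.a (G.e x).1)).root := fun x => PTree.iso_root (G.φ x).iso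
    obtain ⟨τ, hτ, hτ'⟩ := X.exists_desc (σ.hom ≫ Y.c)
      (fun x => (G.φ x).iso.hom ≫ Y.T.idealIncl (Y.c.a (G.e x).1)) (by
        intro x
        -- `F` respects the colours of roots and leaves, which is agreement along the cut
        have h₁ : (⟨G.e x, ((G.φ x).iso.hom.ha (X.T.ideal (X.c.a x.1)).root ≫
            eqToHom (congrArg (Y.T.ideal (Y.c.a (G.e x).1)).α (hroot x))) ≫
              Groupoid.inv (Y.c.ha (G.e x).1)⟩ :
              Σ y : Y.S.Leaf, (X.T.α (X.c.a x.1) ⟶ Y.S.α y.1)) =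
            ⟨PTree.leafEquiv σ x, Groupoid.inv (X.c.ha x.1) ≫ σ.hom.ha x.1⟩ :=
          congrArg (fun k : Fam.Hom _ _ => (⟨k.e x, k.φ x⟩ :
            Σ y : Y.S.Leaf, (X.T.α (X.c.a x.1) ⟶ Y.S.α y.1))) F.w
        have h₂ := sigma_hom_precomp (X.c.ha x.1)
          (sigma_hom_postcomp (fun y : Y.S.Leaf => Y.c.ha y.1) h₁)
        have key : ∀ {a b c d : I} (f : a ⟶ b) (g : b ⟶ d) (k : c ⟶ d),
            f ≫ (g ≫ Groupoid.inv k) ≫ k = f ≫ g := fun f g k => by simp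
        have key' : ∀ {a b c d : I} (f : a ⟶ b) (g : a ⟶ c) (k : c ⟶ d),
            f ≫ (Groupoid.inv f ≫ g) ≫ k = g ≫ k := fun f g k => by simp
        have key'' : ∀ {a b c d : I} (f : a ⟶ b) (g : b ⟶ c) (k : c ⟶ d),
            (f ≫ g ≫ 𝟙 c) ≫ k = f ≫ g ≫ k := fun f g k => by simp
        refine Eq.trans ?_ (h₂.symm.trans (Eq.symm ?_))
        · exact Sigma.ext rfl (heq_of_eq (key' _ _ _).symm)
        · refine sigma_hom_eq_iff.2 ⟨congrArg Subtype.val (hroot x), ?_⟩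
          exact (key'' _ _ _).trans (key _ _ _).symm)
    have hτr : τ.a X.T.root = Y.T.root := by
      rw [← X.root_pres]
      exact (PTree.congr_a hτ X.S.root).trans
        ((congrArg Y.c.a (PTree.iso_root σ)).trans Y.root_pres)
    have hτi : IsIso τ := by
      refine PTree.isIso_of_surjective τ hτr (fun z => ?_) (fun z => ?_)
      · rcases Y.c.exists_a_or_above Y.root_pres z with ⟨y, rfl⟩ | ⟨y, hy⟩
        · refine ⟨X.c.a (σ.inv.a y), (PTree.congr_a hτ _).trans ?_⟩
          exact congrArg Y.c.a (PTree.iso_inv_hom_a σ y)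
        · obtain ⟨x, rfl⟩ := G.e.surjective y
          refine ⟨((G.φ x).iso.inv.a ⟨z, hy⟩).1, (PTree.congr_a (hτ' x) _).trans ?_⟩
          exact congrArg Subtype.val (PTree.iso_inv_hom_a (G.φ x).iso ⟨z, hy⟩)
      · rcases Y.c.exists_n_or_above Y.root_pres z with ⟨y, rfl⟩ | ⟨y, hy⟩
        · refine ⟨X.c.n (σ.inv.n y),
            (congrArg (fun k : X.S ⟶ Y.T => k.n (σ.inv.n y)) hτ).trans ?_⟩
          exact congrArg (fun k : Y.S ⟶ Y.S => Y.c.n (k.n y)) σ.inv_hom_id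
        · obtain ⟨x, rfl⟩ := G.e.surjective y
          refine ⟨((G.φ x).iso.inv.n ⟨z, hy⟩).1,
            (congrArg (fun k : X.T.ideal (X.c.a x.1) ⟶ Y.T =>
              k.n ((G.φ x).iso.inv.n ⟨z, hy⟩)) (hτ' x)).trans ?_⟩
          exact congrArg (fun k : Y.T.ideal (Y.c.a (G.e x).1) ⟶ Y.T.ideal (Y.c.a (G.e x).1) =>
            (k.n ⟨z, hy⟩).1) (G.φ x).iso.inv_hom_id
    let H : X ⟶ Y := ⟨σ, asIso τ, hτ⟩
    refine ⟨H, CommaMorphism.ext ?_ rfl⟩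
    refine Fam.hom_ext_sigma fun x => ?_
    refine PTree.sigma_ideal_ext (T := Y.T) (S := ⟨X.T.ideal (X.c.a x.1)⟩)
      (e := fun y : Y.S.Leaf => Y.c.a y.1) (hw x).symm ?_
    exact (PTree.ideal_comp_incl τ (PTree.congr_a H.comm x.1)).trans (hτ' x)

end Cut

/-! ### Grafting a forest onto leaves of a tree -/

section Grafting

variable {I : Type u₁} {E : Type u₂} {B : Type u₃}
  [Groupoid.{v₁} I] [Groupoid.{v₂} E] [Groupoid.{v₃} B] {P : PolyEndo I E B}

theorem Diagram.walk_s (D : Diagram) (h : Function.Injective D.s) (m : D.M) :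
    D.walk (D.s m) = D.t (D.p m) := by
  have h' : ∃ m', D.s m' = D.s m := ⟨m, rfl⟩
  rw [Diagram.walk, dif_pos h', h h'.choose_spec]

/-- A tree with finitely many of its leaves labelled by trees, and with arrows from the colours of
the roots of these trees to the colours of the leaves. -/
structure Grafting (P : PolyEndo I E B) where
  /-- the tree below -/
  S : PTree P
  /-- the index set of the grafted trees -/
  K : Type
  [fin : Finite K]
  /-- the grafted trees -/
  Q : K → PTree P
  /-- the edges of `S` at which they are grafted -/
  l : K → S.A
  l_inj : Function.Injective l
  l_leaf : ∀ k n, S.t n ≠ l k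
  /-- the identification of the colours of the roots with the colours of the leaves -/
  φ : ∀ k, (Q k).α (Q k).root ⟶ S.α (l k)

namespace Grafting

variable (G : Grafting P)

/-- The pieces of a grafted tree. -/
def piece : Option G.K → PTree P
  | none => G.S
  | some k => G.Q k

/-- The edges of the grafted tree: those of `S` and the non-root edges of the grafted trees, the
latter indexed by marked nodes. -/
abbrev Edge : Type := G.S.A ⊕ Σ k, (G.Q k).M

/-- The decoration of the edges of the grafted tree. -/
def edgeColour : G.Edge → I
  | .inl e => G.S.α e
  | .inr m => (G.Q m.1).α ((G.Q m.1).s m.2)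

open Classical in
/-- The edge of the grafted tree given by an edge of a piece, with the comparison of decorations;
the root edge of a grafted tree becomes the leaf at which that tree is grafted. -/
noncomputable def edge : ∀ j (e : (G.piece j).A), Σ x, ((G.piece j).α e ⟶ G.edgeColour x)
  | none, e => ⟨.inl e, 𝟙 (G.S.α e)⟩
  | some k, e =>
    if h : ∃ m, (G.Q k).s m = e then
      ⟨.inr ⟨k, h.choose⟩, eqToHom (congrArg (G.Q k).α h.choose_spec.symm)⟩
    else
      ⟨.inl (G.l k), eqToHom (congrArg (G.Q k).α
        ((Tree.eq_root_or e).resolve_right h)) ≫ G.φ k⟩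

theorem edge_root (k : G.K) : G.edge (some k) (G.Q k).root = ⟨.inl (G.l k), G.φ k⟩ := by
  have h : ¬ ∃ m, (G.Q k).s m = (G.Q k).root := fun ⟨m, hm⟩ => Tree.s_ne_root m hm
  exact (dif_neg h).trans (Sigma.ext rfl (heq_of_eq (Category.id_comp (G.φ k))))

theorem edge_s (k : G.K) (m : (G.Q k).M) :
    (G.edge (some k) ((G.Q k).s m)).1 = .inr ⟨k, m⟩ := by
  have h : ∃ m', (G.Q k).s m' = (G.Q k).s m := ⟨m, rfl⟩
  refine (congrArg Sigma.fst (dif_pos h)).trans ?_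
  change Sum.inr (⟨k, h.choose⟩ : Σ k, (G.Q k).M) = _
  rw [(G.Q k).s_inj h.choose_spec]

theorem edge_injective (j : Option G.K) : Function.Injective fun e => (G.edge j e).1 := by
  intro e e' h
  match j, e, e', h with
  | none, e, e', h => exact Sum.inl_injective h
  | some k, e, e', h =>
    change (G.edge (some k) e).1 = (G.edge (some k) e').1 at h
    rcases Tree.eq_root_or (T := (G.Q k).toTree) e with rfl | ⟨m, rfl⟩ <;>
      rcases Tree.eq_root_or (T := (G.Q k).toTree) e' with rfl | ⟨m', rfl⟩
    · rfl
    · rw [edge_root, edge_s] at h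
      cases h
    · rw [edge_root, edge_s] at h
      cases h
    · rw [edge_s, edge_s] at h
      cases h
      rfl

/-- A non-root edge of a grafted tree belongs to no other piece. -/
theorem eq_of_edge_eq_edge_s {k : G.K} {m : (G.Q k).M} {j : Option G.K} {e : (G.piece j).A}
    (h : (G.edge j e).1 = (G.edge (some k) ((G.Q k).s m)).1) : j = some k := by
  rw [edge_s] at h
  match j, e, h with
  | none, e, h => cases h
  | some k', e, h =>
    rcases Tree.eq_root_or (T := (G.Q k').toTree) e with rfl | ⟨m', rfl⟩
    · rw [edge_root] at h
      cases h
    · rw [edge_s] at h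
      cases h
      rfl

/-- The root edge of a grafted tree belongs to no other grafted tree. -/
theorem eq_of_edge_eq_edge_root {k k' : G.K} {e : (G.Q k').A}
    (h : (G.edge (some k') e).1 = (G.edge (some k) (G.Q k).root).1) : some k' = some k := by
  rcases Tree.eq_root_or (T := (G.Q k').toTree) e with rfl | ⟨m', rfl⟩
  · rw [edge_root, edge_root] at h
    rw [G.l_inj (Sum.inl_injective h)]
  · rw [edge_s, edge_root] at h
    cases h

/-- The output edge of a node belongs to a grafted tree only if the node does: grafting takes place
at leaves. -/
theorem index_eq_of_edge_t {k : G.K} {e : (G.Q k).A} {j : Option G.K} {n : (G.piece j).N}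
    (h : (G.edge j ((G.piece j).t n)).1 = (G.edge (some k) e).1) : j = some k := by
  rcases Tree.eq_root_or (T := (G.Q k).toTree) e with rfl | ⟨m, rfl⟩
  · match j, n, h with
    | none, n, h =>
      rw [edge_root] at h
      exact absurd (Sum.inl_injective h) (G.l_leaf k n)
    | some k', n, h => exact G.eq_of_edge_eq_edge_root h
  · exact G.eq_of_edge_eq_edge_s h

theorem index_eq_of_edge_s {j j' : Option G.K} {m : (G.piece j).M} {m' : (G.piece j').M}
    (h : (G.edge j ((G.piece j).s m)).1 = (G.edge j' ((G.piece j').s m')).1) : j = j' := by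
  match j, j', m, m', h with
  | none, none, _, _, _ => rfl
  | _, some k, _, m', h => exact G.eq_of_edge_eq_edge_s h
  | some k, none, m, _, h => exact (G.eq_of_edge_eq_edge_s h.symm).symm

/-- The underlying diagram of the grafted tree. -/
noncomputable abbrev diagram : Diagram where
  A := G.Edge
  M := Σ j, (G.piece j).M
  N := Σ j, (G.piece j).N
  s m := (G.edge m.1 ((G.piece m.1).s m.2)).1
  p m := ⟨m.1, (G.piece m.1).p m.2⟩
  t n := (G.edge n.1 ((G.piece n.1).t n.2)).1

theorem diagram_s_inj : Function.Injective G.diagram.s := by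
  rintro ⟨j, m⟩ ⟨j', m'⟩ h
  obtain rfl := G.index_eq_of_edge_s h
  exact congrArg (Sigma.mk j) ((G.piece j).s_inj (G.edge_injective j h))

theorem diagram_t_inj : Function.Injective G.diagram.t := by
  rintro ⟨j, n⟩ ⟨j', n'⟩ h
  have hj : j = j' := by
    match j, j', n, n', h with
    | none, none, _, _, _ => rfl
    | _, some k, _, n', h => exact G.index_eq_of_edge_t h
    | some k, none, n, _, h => exact (G.index_eq_of_edge_t h.symm).symm
  subst hj
  exact congrArg (Sigma.mk j) ((G.piece j).t_inj (G.edge_injective j h))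

theorem diagram_reach (x : G.Edge) : ∃ k : ℕ, G.diagram.walk^[k] x = .inl G.S.root := by
  have step : ∀ j (m : (G.piece j).M),
      (∃ k : ℕ, G.diagram.walk^[k] (G.edge j ((G.piece j).t ((G.piece j).p m))).1 =
        .inl G.S.root) →
      ∃ k : ℕ, G.diagram.walk^[k] (G.edge j ((G.piece j).s m)).1 = .inl G.S.root := by
    rintro j m ⟨k, hk⟩
    refine ⟨k + 1, ?_⟩
    rw [Function.iterate_succ_apply]
    exact (congrArg _ (G.diagram.walk_s G.diagram_s_inj ⟨j, m⟩)).trans hk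
  have hS : ∀ e : G.S.A, ∃ k : ℕ, G.diagram.walk^[k] (.inl e) = .inl G.S.root := fun e =>
    Tree.root_induction (T := G.S.toTree)
      (Q := fun e => ∃ n : ℕ, G.diagram.walk^[n] (G.edge none e).1 = .inl G.S.root) ⟨0, rfl⟩ (step none) e
  match x with
  | .inl e => exact hS e
  | .inr ⟨k, m⟩ =>
    rw [← G.edge_s k m]
    refine Tree.root_induction (T := (G.Q k).toTree)
      (Q := fun e => ∃ n : ℕ, G.diagram.walk^[n] (G.edge (some k) e).1 = .inl G.S.root)
      ?_ (step (some k)) _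
    rw [edge_root]
    exact hS _

/-- The grafted tree: its nodes, marked nodes and their decorations are those of the pieces. -/
noncomputable def tree : PTree P where
  toDiagram := G.diagram
  finA := by
    have := G.fin
    have := G.S.finA
    have := fun k => (G.Q k).finM
    exact inferInstanceAs (Finite (G.S.A ⊕ Σ k, (G.Q k).M))
  finM := by
    have := G.fin
    have := fun j => (G.piece j).finM
    exact inferInstanceAs (Finite (Σ j, (G.piece j).M))
  finN := by
    have := G.fin
    have := fun j => (G.piece j).finN
    exact inferInstanceAs (Finite (Σ j, (G.piece j).N))
  t_inj := G.diagram_t_inj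
  s_inj := G.diagram_s_inj
  root := .inl G.S.root
  compl_range_s := by
    ext x
    simp only [Set.mem_compl_iff, Set.mem_range, Set.mem_singleton_iff]
    constructor
    · intro h
      match x, h with
      | .inl e, h =>
        rcases Tree.eq_root_or (T := G.S.toTree) e with rfl | ⟨m, rfl⟩
        · rfl
        · exact absurd ⟨⟨none, m⟩, rfl⟩ h
      | .inr ⟨k, m⟩, h => exact absurd ⟨⟨some k, m⟩, G.edge_s k m⟩ h
    · rintro rfl ⟨⟨j, m⟩, h⟩
      match j, m, h with
      | none, m, h => exact Tree.s_ne_root (T := G.S.toTree) m (Sum.inl_injective h)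
      | some k, m, h =>
        have := (G.edge_s k m).symm.trans h
        cases this
  reach := G.diagram_reach
  α := G.edgeColour
  β m := (G.piece m.1).β m.2
  γ n := (G.piece n.1).γ n.2
  sIso m := (G.piece m.1).sIso m.2 ≫ (G.edge m.1 ((G.piece m.1).s m.2)).2
  pIso m := (G.piece m.1).pIso m.2
  tIso n := (G.piece n.1).tIso n.2 ≫ (G.edge n.1 ((G.piece n.1).t n.2)).2
  pcart := by
    refine (comparison_isEquivalence_iff _ _ _ _ _).2 ?_
    rintro ⟨j, n⟩ c ψ
    obtain ⟨⟨m, f⟩, hx, hx'⟩ :=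
      (comparison_isEquivalence_iff _ _ _ _ _).1 (G.piece j).pcart n c ψ
    have lift : ∀ {z w : Σ n : (G.piece j).N, (P.p.obj c ⟶ (G.piece j).γ n)}, z = w →
        (⟨⟨j, z.1⟩, z.2⟩ : Σ n : (Σ j, (G.piece j).N), (P.p.obj c ⟶ (G.piece n.1).γ n.2)) =
          ⟨⟨j, w.1⟩, w.2⟩ := fun h => by rw [h]
    refine ⟨⟨⟨j, m⟩, f⟩, lift hx, ?_⟩
    rintro ⟨⟨j', m'⟩, f'⟩ h
    obtain rfl : j' = j := congrArg (fun z => z.1.1) h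
    rw [Sigma.mk.injEq] at h
    obtain ⟨h1, h2⟩ := h
    have h1' : (G.piece j').p m' = n := by simpa using h1
    have h3 : (⟨m', f'⟩ : Σ m, (c ⟶ (G.piece j').β m)) = ⟨m, f⟩ := by
      apply hx'
      rw [Sigma.mk.injEq]
      exact ⟨h1', h2⟩
    rw [Sigma.mk.injEq] at h3
    obtain ⟨rfl, h3⟩ := h3
    rw [eq_of_heq h3]

/-- The embeddings of the pieces into the grafted tree. -/
noncomputable def incl (j : Option G.K) : G.piece j ⟶ G.tree :=
  { a := fun e => (G.edge j e).1
    m := fun m => ⟨j, m⟩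
    n := fun n => ⟨j, n⟩
    s_comm := fun _ => rfl
    p_comm := fun _ => rfl
    t_comm := fun _ => rfl
    cart := by
      rintro n ⟨j', m⟩ h
      obtain rfl : j' = j := congrArg Sigma.fst h
      have h' : (G.piece j').p m = n := eq_of_heq (Sigma.mk.inj_iff.1 h).2
      exact ⟨m, ⟨h', rfl⟩, fun m' hm' => eq_of_heq (Sigma.mk.inj_iff.1 hm'.2).2⟩
    ha := fun e => (G.edge j e).2
    hm := fun m => 𝟙 ((G.piece j).β m)
    hn := fun n => 𝟙 ((G.piece j).γ n)
    sq_s := fun m => by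
      change (G.piece j).sIso m ≫ (G.edge j ((G.piece j).s m)).2 ≫ 𝟙 _ =
        P.s.map (𝟙 _) ≫ (G.piece j).sIso m ≫ (G.edge j ((G.piece j).s m)).2
      simp
    sq_p := fun m => by
      change (G.piece j).pIso m ≫ 𝟙 _ ≫ 𝟙 _ = P.p.map (𝟙 _) ≫ (G.piece j).pIso m
      simp
    sq_t := fun n => by
      change (G.piece j).tIso n ≫ (G.edge j ((G.piece j).t n)).2 ≫ 𝟙 _ =
        P.t.map (𝟙 _) ≫ (G.piece j).tIso n ≫ (G.edge j ((G.piece j).t n)).2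
      simp : PTree.Hom (G.piece j) G.tree }

/-- The cut of a grafted tree at the edges along which the grafting takes place. -/
noncomputable def cutTree : CutTree P where
  S := G.S
  T := G.tree
  c := G.incl none
  root_pres := rfl

/-- The embedding of a grafted tree into the ideal subtree above the leaf at which it is grafted. -/
noncomputable def toIdeal (k : G.K) : G.Q k ⟶ G.tree.ideal (.inl (G.l k)) :=
  PTree.toIdeal (G.incl (some k)) (congrArg Sigma.fst (G.edge_root k))

/-- The edges above the leaf at which a tree is grafted come from that tree. -/
theorem exists_edge_of_above {k : G.K} {x : G.tree.A}
    (h : G.tree.Above (Sum.inl (G.l k) : G.Edge) x) :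
    ∃ e, (G.edge (some k) e).1 = x := by
  induction h with
  | refl => exact ⟨_, congrArg Sigma.fst (G.edge_root k)⟩
  | step m _ ih =>
    obtain ⟨e, he⟩ := ih
    obtain ⟨j, m⟩ := m
    obtain rfl : j = some k := G.index_eq_of_edge_t he.symm
    exact ⟨(G.Q k).s m, rfl⟩

/-- A grafted tree is recovered as the ideal subtree above the leaf at which it is grafted. -/
instance isIso_toIdeal (k : G.K) : IsIso (G.toIdeal k) := by
  refine PTree.isIso_of_surjective _ (Subtype.ext (congrArg Sigma.fst (G.edge_root k))) ?_ ?_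
  · rintro ⟨x, hx⟩
    obtain ⟨e, he⟩ := G.exists_edge_of_above hx
    exact ⟨e, Subtype.ext he⟩
  · rintro ⟨⟨j, n⟩, hn⟩
    obtain ⟨e, he⟩ := G.exists_edge_of_above hn
    obtain rfl : j = some k := G.index_eq_of_edge_t he.symm
    exact ⟨n, rfl⟩

end Grafting

variable (P)

/-- The homotopy pullback is exhausted by cuts: the tree with the forest grafted onto its leaves
realizes a given object. -/
instance : (cutToPullback P).EssSurj where
  mem_essImage Z := by
    let ρ : Fam.Hom ((forestRootMap P).obj Z.left) ((leafMap P).obj Z.right) := Z.hom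
    let G : Grafting P :=
      { S := Z.right.of
        K := Z.left.ι
        fin := Z.left.fin
        Q := fun k => (Z.left.obj k).of
        l := fun k => (ρ.e k).1
        l_inj := fun _ _ h => ρ.e.injective (Subtype.ext h)
        l_leaf := fun k => (ρ.e k).2
        φ := ρ.φ }
    let f : Fam.Hom Z.left ((upperForest P).obj G.cutTree) :=
      ⟨ρ.e, fun k => ⟨@asIso _ _ _ _ (G.toIdeal k) (G.isIso_toIdeal k)⟩⟩
    let g : Z ⟶ (cutToPullback P).obj G.cutTree :=
      { left := f
        right := 𝟙 Z.right
        w := by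
          refine Fam.hom_ext_sigma fun k => Sigma.ext rfl (heq_of_eq ?_)
          have key : ∀ {a b c : I} (f : a ⟶ b) (g : b ⟶ c) (k : a ⟶ c), f ≫ g = k →
              (f ≫ g) ≫ Groupoid.inv (𝟙 c) = k ≫ 𝟙 c := fun f g k h => by simpa using h
          exact key _ _ _ (sigma_hom_eq_iff.1 (G.edge_root k)).2 }
    exact ⟨G.cutTree, ⟨(Comma.isoMk ((Groupoid.isoEquivHom _ _).symm g.left)
      ((Groupoid.isoEquivHom _ _).symm g.right) g.w).symm⟩⟩

instance : (cutToPullback P).IsEquivalence where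

end Grafting

end FaaDiBruno

/-! ### The equivalences over `F × T` -/

open FaaDiBruno in
/-- The homotopy sums of `cut(T)` over `T`, of `F_{L(S)}` over `S`, and of `F_N × _N T` over
`N`, are equivalent as groupoids over `F × T`, for an arbitrary polynomial endofunctor `P`. -/
theorem mainTheorem1 {I E B : Type*} [Groupoid I] [Groupoid E] [Groupoid B]
    (P : PolyEndo I E B) :
    (∃ e : CutSum P ≌ LeafSum P, Nonempty (e.functor ⋙ leafSumMap P ≅ cutSumMap P)) ∧
    (∃ e : LeafSum P ≌ ProfileSum P, Nonempty (e.functor ⋙ profileSumMap P ≅ leafSumMap P)) := by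
  let π := (Comma.fst (forestRootMap P) (leafMap P)).prod' (Comma.snd _ _)
  let eL : LeafSum P ≌ HPullback (forestRootMap P) (leafMap P) :=
    CostructuredArrow.grothendieckPrecompFunctorEquivalence (forestRootMap P) (leafMap P)
  let eC : CutSum P ≌ HPullback (forestRootMap P) (leafMap P) :=
    ((cutComponent P).asEquivalence.symm.trans
      (CostructuredArrow.grothendieckProj (totalTree P)).asEquivalence).trans
        (cutToPullback P).asEquivalence
  let eN : ProfileSum P ≌ HPullback (forestRootMap P) (leafMap P) :=
    (prodFibreToPullback (forestRootMap P) (leafMap P)).asEquivalence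
  -- the three structure maps are definitionally `eC`, `eL` and `eN` followed by `π`
  refine ⟨⟨eC.trans eL.symm, ⟨?_⟩⟩, ⟨eL.trans eN.symm, ⟨?_⟩⟩⟩
  · exact Functor.isoWhiskerRight (Functor.isoWhiskerLeft eC.functor eL.counitIso) π
  · exact Functor.isoWhiskerRight (Functor.isoWhiskerLeft eL.functor eN.counitIso) π
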